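/- Let $N\ge 2$. Consider a game with players $i=1,\dots,N$, actions $x_i\in\mathbb R$, $\mathbf x=(x_1,\dots,x_N)^T$, and costs $f_i:\mathbb R^N\to\mathbb R$, player $i$ minimizing $f_i$ over its own action $x_i$. A profile $\mathbf x^*$ is a Nash equilibrium if $f_i(x_i^*,\mathbf x_{-i}^*)\le f_i(x_i,\mathbf x_{-i}^*)$ for all $i$ and all $x_i\in\mathbb R$. The norm $\|\cdot\|$ is the Euclidean norm. Assume: 1. each $f_i$ is twice continuously differentiable; 2. there is $m>0$ such that $(\mathbf x-\mathbf z)^T(\Upsilon(\mathbf x)-\Upsilon(\mathbf z))\ge m\|\mathbf x-\mathbf z\|^2$ for all $\mathbf x,\mathbf z\in\mathbb R^N$, where $\Upsilon(\mathbf x)=\big(\tfrac{\partial f_i}{\partial x_i}(\mathbf x)\big)_{i=1}^N$; 3. $(a_{ij})$ is the weighted adjacency matrix of an undirected connected graph on $\{1,\dots,N\}$: $a_{ij}=a_{ji}\ge 0$, $a_{ii}=0$, and the graph whose edges are the pairs with $a_{ij}>0$ is connected; 4. each disturbance $d_i:[t_0,\infty)\to\mathbb R$ is continuously differentiable with bounded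 derivative. Let $\bar\theta_{ij},k_{i1},k_{i2}$ be fixed positive constants. For $\theta,\sigma>0$ consider, on $[t_0,\infty)$, the dynamics $\dot x_i=u_i+d_i(t)$ with the strategy $$u_i=-\frac{\partial f_i}{\partial x_i}(\mathbf y_i)-\hat z_i,\qquad \mathbf y_i=(y_{i1},\dots,y_{iN})^T,$$ $$\dot y_{ij}=-\theta\bar\theta_{ij}\Big(\sum_{k=1}^N a_{ik}(y_{ij}-y_{kj})+a_{ij}(y_{ij}-x_j)\Big),$$ $$\dot{\hat x}_i=u_i+\hat z_i+\sigma k_{i1}(x_i-\hat x_i),\qquad \dot{\hat z}_i=\sigma^2k_{i2}(x_i-\hat x_i).$$ Then the game has exactly one Nash equilibrium $\mathbf x^*$. Let $\mathcal E(t)$ be the vector that stacks all the errors $x_i-\hat x_i$, $d_i(t)-\hat z_i$, $y_{ij}-x_j$ and $x_i-x_i^*$ ($1\le i,j\le N$) at time $t$. For any $v_1,v_2>0$ there are $\theta^*>0$ and $\sigma^*>0$ such that for all $\theta>\theta^*$ and all $\sigma>\sigma^*$: from every initial state with $\|\mathcal E(t_0)\|\le v_1$ the closed-loop system has a solution on $[t_0,\infty)$,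 and there is $\bar T\ge t_0$ such that every solution on $[t_0,\infty)$ with $\|\mathcal E(t_0)\|\le v_1$ satisfies $\|\mathcal E(t)\|\le v_2$ for all $t\ge\bar T$. -/

import Mathlib

open Set

noncomputable section

namespace NashPI

/-- The partial derivative `∂f_i/∂x_i` of player `i`'s cost with respect to its own action,
evaluated at the action profile `x`. -/
def ownPartial {N : ℕ} (f : Fin N → (Fin N → ℝ) → ℝ) (i : Fin N) (x : Fin N → ℝ) : ℝ :=
  fderiv ℝ (f i) x (Pi.single i 1)

/-- The pseudo-gradient `Υ(x) = [∂f_i/∂x_i (x)]_vec`. -/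
def pseudoGradient {N : ℕ} (f : Fin N → (Fin N → ℝ) → ℝ) (x : Fin N → ℝ) : Fin N → ℝ :=
  fun i => ownPartial f i x

/-- Strong monotonicity of the pseudo-gradient with constant `m`
(the norm is the Euclidean one). -/
def StronglyMonotone {N : ℕ} (f : Fin N → (Fin N → ℝ) → ℝ) (m : ℝ) : Prop :=
  ∀ x z : Fin N → ℝ,
    m * ‖WithLp.toLp 2 (x - z)‖ ^ 2 ≤ (x - z) ⬝ᵥ (pseudoGradient f x - pseudoGradient f z)

/-- Nash equilibrium: no player can decrease its cost by a unilateral deviation. -/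
def IsNash {N : ℕ} (f : Fin N → (Fin N → ℝ) → ℝ) (xs : Fin N → ℝ) : Prop :=
  ∀ (i : Fin N) (r : ℝ), f i xs ≤ f i (Function.update xs i r)

/-- `a` is the weighted adjacency matrix of an undirected connected graph without self-loops,
whose edges are the pairs of nodes with positive weight. -/
structure IsUndirectedConnected {N : ℕ} (a : Matrix (Fin N) (Fin N) ℝ) : Prop where
  nonneg : ∀ i j, 0 ≤ a i j
  diag : ∀ i, a i i = 0
  symm : ∀ i j, a i j = a j i
  connected : (SimpleGraph.fromRel fun i j => 0 < a i j).Connected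

/-- `w` is continuously differentiable with bounded derivative on `[t₀, ∞)`. -/
def IsAdmissibleDisturbance (t₀ : ℝ) (w : ℝ → ℝ) : Prop :=
  ContDiffOn ℝ 1 w (Ici t₀) ∧ ∃ B : ℝ, ∀ t ∈ Ici t₀, |derivWithin w (Ici t₀) t| ≤ B

/-- State of the closed loop: the actions `x i`, player `i`'s estimate `y i j` of player `j`'s
action, and the observer states `xhat i`, `zhat i`. -/
structure State (N : ℕ) where
  x : Fin N → ℝ
  y : Fin N → Fin N → ℝ
  xhat : Fin N → ℝ
  zhat : Fin N → ℝ

/-- The control law `u_i = -∂f_i/∂x_i (y_i) - ẑ_i`. -/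
def control {N : ℕ} (f : Fin N → (Fin N → ℝ) → ℝ) (s : State N) (i : Fin N) : ℝ :=
  -ownPartial f i (s.y i) - s.zhat i

/-- `s` solves the closed-loop system on `[t₀, ∞)` (with a one-sided derivative at `t₀`). -/
structure IsSolution {N : ℕ} (f : Fin N → (Fin N → ℝ) → ℝ) (a : Matrix (Fin N) (Fin N) ℝ)
    (t₀ : ℝ) (d : Fin N → ℝ → ℝ) (k₁ k₂ : Fin N → ℝ) (θbar : Fin N → Fin N → ℝ)
    (θ σ : ℝ) (s : ℝ → State N) : Prop where
  ode_x : ∀ i, ∀ t ∈ Ici t₀,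
    HasDerivWithinAt (fun τ => (s τ).x i) (control f (s t) i + d i t) (Ici t₀) t
  ode_y : ∀ i j, ∀ t ∈ Ici t₀,
    HasDerivWithinAt (fun τ => (s τ).y i j)
      (-(θ * θbar i j) * ((∑ k, a i k * ((s t).y i j - (s t).y k j))
        + a i j * ((s t).y i j - (s t).x j))) (Ici t₀) t
  ode_xhat : ∀ i, ∀ t ∈ Ici t₀,
    HasDerivWithinAt (fun τ => (s τ).xhat i)
      (control f (s t) i + (s t).zhat i + (σ * k₁ i) * ((s t).x i - (s t).xhat i)) (Ici t₀) t
  ode_zhat : ∀ i, ∀ t ∈ Ici t₀,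
    HasDerivWithinAt (fun τ => (s τ).zhat i)
      ((σ ^ 2 * k₂ i) * ((s t).x i - (s t).xhat i)) (Ici t₀) t

/-- The stacked error `(ζ₁, ζ₂, η, ξ)` relative to the action profile `xs`, when the current value
of the disturbance is `w`: `ζ₁ = x - x̂`, `ζ₂ = w - ẑ`, `η i j = y i j - x j`, `ξ = x - xs`. -/
def errorVec {N : ℕ} (xs w : Fin N → ℝ) (s : State N) :
    EuclideanSpace ℝ ((Fin N ⊕ Fin N) ⊕ ((Fin N × Fin N) ⊕ Fin N)) :=
  WithLp.toLp 2 (Sum.elim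
    (Sum.elim (fun i => s.x i - s.xhat i) (fun i => w i - s.zhat i))
    (Sum.elim (fun p => s.y p.1 p.2 - s.x p.2) (fun i => s.x i - xs i)))

end NashPI

end

noncomputable section

namespace NashPI

open Filter Topology

/-! Nash equilibria are exactly the zeros of the pseudo-gradient `g`. A zero exists because strong
monotonicity makes `∑ g i ^ 2` coercive and forces `g` to vanish at its minimizer
(`exists_forall_ownPartial_eq_zero`); strong monotonicity also makes it unique.

For the dynamics, put `e₁ = x - x̂` and `e₂ = (d - ẑ) / σ`. Then `ẋ` contains `σ e₂`, which is not
bounded uniformly in `σ`. The combination `e₁ - (k₁ / k₂) e₂` has derivative `σ e₂ - k₁ ḋ / (σ k₂)`,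
so subtracting it from `x` gives a coordinate `p` with `ṗ i = -g i (y i) + k₁ ḋ / (σ k₂)`, whose
speed on a ball does not depend on the gains. With `q i j = y i j - p j` the loop becomes a cascade
with three Lyapunov functions: `lyapE` decays at rate of order `σ`; `lyapQ` decays at rate of order
`θ` by positivity of the pinned graph Laplacian and is driven by `lyapE`; `lyapP` decays at rate `m`
by strong monotonicity and is driven by `lyapQ`.

The estimates for `lyapQ` and `lyapP` hold only on a ball. The constants are therefore fixed in this
order: decay rates and the `lyapE`-to-`lyapQ` coupling, then the levels of the three functions, then
the ball, then the constants that depend on the ball, and last the gains (`exists_gains_errField`).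
`exists_gains_of_cascade` shows that the levels are never exceeded and that all three functions
become small, with `lyapE` of size `o(1 / σ ^ 2)` as needed for `d - ẑ = σ e₂`. Solutions exist
because a field cut off outside the ball has global solutions, and invariance shows that these never
leave the ball. -/

/-! ### Invariance and scalar differential inequalities. -/

/-- A sublevel region `{V i ≤ c i}` is forward invariant when each `V i` decreases strictly at
every point of the region where `V i = c i`. -/
theorem forall_le_of_deriv_neg_on_boundary {ι : Type*} [Finite ι] {V : ι → ℝ → ℝ} {c : ι → ℝ}
    {t₀ : ℝ} (hcont : ∀ i, ContinuousOn (V i) (Ici t₀)) (h0 : ∀ i, V i t₀ ≤ c i)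
    (hb : ∀ t, t₀ ≤ t → (∀ i, V i t ≤ c i) → ∀ i, V i t = c i →
      ∃ v < 0, HasDerivWithinAt (V i) v (Ici t₀) t) :
    ∀ t, t₀ ≤ t → ∀ i, V i t ≤ c i := by
  intro b hb'
  have key : Icc t₀ b ⊆ {t | ∀ i, V i t ≤ c i} := by
    -- Continuous induction on `[t₀, b]`: an inequality that is strict at `x` persists by
    -- continuity, and one that is tight persists to the right because the slopes there are
    -- eventually negative.
    apply IsClosed.Icc_subset_of_forall_mem_nhdsWithin
    · have : {t | ∀ i, V i t ≤ c i} ∩ Icc t₀ b = Icc t₀ b ∩ ⋂ i, Icc t₀ b ∩ V i ⁻¹' Iic (c i) := by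
        ext t
        simp only [mem_inter_iff, mem_ofPred_eq, mem_iInter, mem_preimage, mem_Iic]
        exact ⟨fun h => ⟨h.2, fun i => ⟨h.2, h.1 i⟩⟩, fun h => ⟨fun i => (h.2 i).2, h.1⟩⟩
      rw [this]
      refine isClosed_Icc.inter (isClosed_iInter fun i => ?_)
      exact ((hcont i).mono Icc_subset_Ici_self).preimage_isClosed_of_isClosed isClosed_Icc
        isClosed_Iic
    · exact h0
    · rintro x ⟨hx, hx0, -⟩
      have hsub : Ioi x ⊆ Ici t₀ := fun y hy => hx0.trans (le_of_lt hy)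
      refine eventually_all.2 fun i => ?_
      rcases (hx i).lt_or_eq with h | h
      · have : Tendsto (V i) (𝓝[>] x) (𝓝 (V i x)) := ((hcont i) x hx0).mono hsub
        exact (this.eventually_lt_const h).mono fun y hy => hy.le
      · obtain ⟨v, hv, hd⟩ := hb x hx0 hx i h
        have h1 := (hd.mono hsub).limsup_slope_le' (by simp) hv
        filter_upwards [h1, self_mem_nhdsWithin] with y hy hxy
        rw [slope_def_field, div_lt_iff₀ (sub_pos.2 hxy), zero_mul] at hy
        linarith
  exact key ⟨hb', le_rfl⟩

/-- Grönwall comparison: `(V - β / α) * exp (α (t - t₀))` has nonpositive derivative. -/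
theorem le_add_exp_of_deriv_le {V V' : ℝ → ℝ} {t₀ α β : ℝ} (hα : 0 < α)
    (hV : ∀ t, t₀ ≤ t → HasDerivWithinAt V (V' t) (Ici t₀) t)
    (hle : ∀ t, t₀ ≤ t → V' t ≤ -α * V t + β) {t : ℝ} (ht : t₀ ≤ t) :
    V t ≤ β / α + (V t₀ - β / α) * Real.exp (-(α * (t - t₀))) := by
  have hexp : ∀ x, HasDerivWithinAt (fun τ => Real.exp (α * (τ - t₀)))
      (Real.exp (α * (x - t₀)) * α) (Ici t₀) x := fun x => by
    have : HasDerivAt (fun τ : ℝ => α * (τ - t₀)) α x := by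
      simpa using ((hasDerivAt_id x).sub_const t₀).const_mul α
    exact this.exp.hasDerivWithinAt
  have hd : ∀ x, t₀ ≤ x → HasDerivWithinAt (fun τ => (V τ - β / α) * Real.exp (α * (τ - t₀)))
      (V' x * Real.exp (α * (x - t₀)) + (V x - β / α) * (Real.exp (α * (x - t₀)) * α))
      (Ici t₀) x := fun x hx => ((hV x hx).sub_const _).mul (hexp x)
  have hanti : AntitoneOn (fun τ => (V τ - β / α) * Real.exp (α * (τ - t₀))) (Ici t₀) := by
    refine antitoneOn_of_hasDerivWithinAt_nonpos (convex_Ici t₀)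
      (fun x hx => (hd x hx).continuousWithinAt)
      (fun x hx => (hd x (interior_subset hx)).mono interior_subset) ?_
    intro x hx
    have h1 := hle x (interior_subset hx)
    have h2 : V' x * Real.exp (α * (x - t₀)) + (V x - β / α) * (Real.exp (α * (x - t₀)) * α)
        = (V' x + α * V x - β) * Real.exp (α * (x - t₀)) := by field_simp; ring
    rw [h2]
    exact mul_nonpos_of_nonpos_of_nonneg (by linarith) (Real.exp_pos _).le
  have h := hanti (mem_Ici.2 le_rfl) (mem_Ici.2 ht) ht
  simp only [sub_self, mul_zero, Real.exp_zero, mul_one] at h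
  rw [Real.exp_neg, ← div_eq_mul_inv, ← sub_le_iff_le_add', le_div_iff₀ (Real.exp_pos _)]
  exact h

theorem exists_time_le_of_deriv_le (t₀ : ℝ) {α β R ε : ℝ} (hα : 0 < α) (hβ : 0 ≤ β) (hε : 0 < ε) :
    ∃ T, t₀ ≤ T ∧ ∀ V V' : ℝ → ℝ, (∀ t, t₀ ≤ t → HasDerivWithinAt V (V' t) (Ici t₀) t) →
      (∀ t, t₀ ≤ t → V' t ≤ -α * V t + β) → V t₀ ≤ R → ∀ t, T ≤ t → V t ≤ β / α + ε := by
  have hlim : Tendsto (fun t => |R| * Real.exp (-(α * (t - t₀)))) atTop (𝓝 (|R| * 0)) := by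
    refine Tendsto.const_mul _ (Real.tendsto_exp_neg_atTop_nhds_zero.comp ?_)
    exact (tendsto_atTop_add_const_right _ (-t₀) tendsto_id).const_mul_atTop hα
  rw [mul_zero] at hlim
  obtain ⟨T, hT⟩ := eventually_atTop.1 ((hlim.eventually_lt_const hε).and (eventually_ge_atTop t₀))
  refine ⟨T, (hT T le_rfl).2, fun V V' hV hle h0 t ht => ?_⟩
  obtain ⟨h1, h2⟩ := hT t ht
  have h3 := le_add_exp_of_deriv_le hα hV hle h2
  have h4 : (V t₀ - β / α) * Real.exp (-(α * (t - t₀))) ≤ |R| * Real.exp (-(α * (t - t₀))) := by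
    refine mul_le_mul_of_nonneg_right ?_ (Real.exp_pos _).le
    have := div_nonneg hβ hα.le
    linarith [le_abs_self R]
  linarith

/-! ### The three-level cascade. -/

/-- Three nonnegative functions coupled by a cascade of differential inequalities, which are
required only as long as the functions stay below the given levels. -/
structure IsCascade (α β m Ce Cq CL Cp Cd Re Rq Rp θ σ t₀ : ℝ) (Ve Vq Vp : ℝ → ℝ) : Prop where
  nonneg_e : ∀ t, 0 ≤ Ve t
  nonneg_q : ∀ t, 0 ≤ Vq t
  nonneg_p : ∀ t, 0 ≤ Vp t
  cont_e : ContinuousOn Ve (Ici t₀)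
  cont_q : ContinuousOn Vq (Ici t₀)
  cont_p : ContinuousOn Vp (Ici t₀)
  init_e : Ve t₀ ≤ Re
  init_q : Vq t₀ ≤ Rq
  init_p : Vp t₀ ≤ Rp
  deriv_le : ∀ t, t₀ ≤ t → Ve t ≤ Re → Vq t ≤ Rq → Vp t ≤ Rp + 1 →
    ∃ e q p, HasDerivWithinAt Ve e (Ici t₀) t ∧ HasDerivWithinAt Vq q (Ici t₀) t ∧
      HasDerivWithinAt Vp p (Ici t₀) t ∧
      e ≤ -(σ * α) * Ve t + Ce / σ ^ 3 ∧
      q ≤ -(θ * β) * Vq t + θ * (Cq * Ve t) + CL / θ ∧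
      p ≤ -m * Vp t + Cp * Vq t + Cd / σ ^ 2

/-- `Vp` alone need not decrease at its level, since `Cp * Vq` may be large during the transient.
The weighted sum `W = Vp + (A / θ) Vq + (B / σ) Ve` does: the fast decay of `Vq` and `Ve` pays for
the coupling, while the weights are so small that `W` exceeds `Vp` by at most `1` initially. The
condition `Cq * Re < β * Rq` lets `Vq` decrease at its level, uniformly in `θ`. -/
theorem exists_gains_of_cascade {α β m Ce Cq CL Cp Cd Re Rq Rp ε : ℝ} (hα : 0 < α) (hβ : 0 < β)
    (hm : 0 < m) (hCe : 0 ≤ Ce) (hCq : 0 ≤ Cq) (hCL : 0 ≤ CL) (hCp : 0 ≤ Cp) (hCd : 0 ≤ Cd)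
    (hRe : 0 < Re) (hRq : Cq * Re < β * Rq) (hRp : 0 ≤ Rp) (hε : 0 < ε) :
    ∃ θs σs : ℝ, 1 ≤ θs ∧ 1 ≤ σs ∧ ∀ θ σ t₀ : ℝ, θs < θ → σs < σ →
      (∀ Ve Vq Vp, IsCascade α β m Ce Cq CL Cp Cd Re Rq Rp θ σ t₀ Ve Vq Vp →
        ∀ t, t₀ ≤ t → Ve t ≤ Re ∧ Vq t ≤ Rq ∧ Vp t ≤ Rp + 1) ∧
      ∃ T, t₀ ≤ T ∧ ∀ Ve Vq Vp, IsCascade α β m Ce Cq CL Cp Cd Re Rq Rp θ σ t₀ Ve Vq Vp →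
        ∀ t, T ≤ t → σ ^ 2 * Ve t ≤ ε ∧ Vq t ≤ ε ∧ Vp t ≤ ε := by
  have hRq0 : 0 < Rq := by
    have : 0 ≤ Cq * Re := by positivity
    exact pos_of_mul_pos_right (this.trans_lt hRq) hβ.le
  -- `A` absorbs `Cp * Vq` and leaves `-Vq`; `B` then absorbs `A * Cq * Ve` and leaves `-Ve`. These
  -- remainders give the decay rate `μ` of `W`.
  obtain ⟨A, hA, hAβ⟩ : ∃ A > 0, A * β = Cp + 1 := ⟨(Cp + 1) / β, by positivity, by field_simp⟩
  obtain ⟨B, hB, hBα⟩ : ∃ B > 0, B * α = A * Cq + 1 :=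
    ⟨(A * Cq + 1) / α, by positivity, by field_simp⟩
  obtain ⟨μ, hμ, hμm, hμ1⟩ : ∃ μ > 0, μ ≤ m ∧ μ ≤ 1 :=
    ⟨min m 1, by positivity, min_le_left _ _, min_le_right _ _⟩
  -- `κ` bounds the residual forcing of `W`: `κ < μ` gives decrease at the level `Rp + 1`, and `κ /
  -- μ ≤ ε / 2` gives the final accuracy.
  obtain ⟨κ, hκ, hκ1, hκε⟩ : ∃ κ > 0, κ < μ ∧ κ ≤ μ * (ε / 2) := by
    refine ⟨min (μ / 2) (μ * (ε / 2)), by positivity, ?_, min_le_right _ _⟩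
    exact (min_le_left _ _).trans_lt (by linarith)
  -- `δ` is the eventual bound on `σ ^ 2 * Ve`, small enough that its effect on `Vq` is at most `ε /
  -- 3`.
  obtain ⟨δ, hδ, hδε, hδq⟩ : ∃ δ > 0, δ ≤ ε ∧ Cq * δ ≤ β * (ε / 3) := by
    refine ⟨min ε (β * (ε / 3) / (Cq + 1)), by positivity, min_le_left _ _, ?_⟩
    calc Cq * min ε (β * (ε / 3) / (Cq + 1)) ≤ (Cq + 1) * (β * (ε / 3) / (Cq + 1)) := by
          gcongr
          · linarith
          · exact min_le_right _ _
      _ = _ := by field_simp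
  have hdiv : ∀ C r : ℝ, 0 < r → ∀ᶠ x : ℝ in atTop, C / x < r := fun C r hr =>
    (tendsto_const_nhds.div_atTop tendsto_id).eventually_lt_const hr
  have hgap : 0 < β * Rq - Cq * Re := by linarith
  obtain ⟨θs, hθs⟩ := eventually_atTop.1 <| (eventually_ge_atTop 1).and <|
    (eventually_ge_atTop A).and <| (hdiv (A * Rq) (1 / 2) (by norm_num)).and <|
    (hdiv CL _ hgap).and <| (hdiv (A * CL) (κ / 2) (by positivity)).and
    (hdiv CL (β * (ε / 3)) (by positivity))
  obtain ⟨σs, hσs⟩ := eventually_atTop.1 <| (eventually_ge_atTop 1).and <|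
    (eventually_ge_atTop B).and <| (hdiv (B * Re) (1 / 2) (by norm_num)).and <|
    (hdiv Ce (α * Re) (by positivity)).and <| (hdiv (Cd + B * Ce) (κ / 2) (by positivity)).and
    (hdiv Ce (α * (δ / 2)) (by positivity))
  refine ⟨θs, σs, (hθs θs le_rfl).1, (hσs σs le_rfl).1, fun θ σ t₀ hθ hσ => ?_⟩
  obtain ⟨hθ1, hθA, hθq, hθL, hθκ, hθε⟩ := hθs θ hθ.le
  obtain ⟨hσ1, hσB, hσe, hσC, hσκ, hσδ⟩ := hσs σ hσ.le
  have hθ0 : 0 < θ := by linarith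
  have hσ0 : 0 < σ := by linarith
  clear hθs hσs
  have hpow : ∀ C : ℝ, 0 ≤ C → ∀ x : ℝ, 1 ≤ x → ∀ n : ℕ, n ≠ 0 → C / x ^ n ≤ C / x :=
    fun C hC x hx n hn => by
      gcongr
      exact le_self_pow₀ hx hn
  have hAθ : A / θ ≤ 1 := (div_le_one hθ0).2 hθA
  have hBσ : B / σ ≤ 1 := (div_le_one hσ0).2 hσB
  have hκsum : Cd / σ ^ 2 + A * (CL / θ ^ 2) + B * (Ce / σ ^ 4) ≤ κ := by
    have h1 := hpow _ hCd σ hσ1 2 (by norm_num)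
    have h2 := hpow _ (mul_nonneg hA.le hCL) θ hθ1 2 (by norm_num)
    have h3 := hpow _ (mul_nonneg hB.le hCe) σ hσ1 4 (by norm_num)
    rw [mul_div_assoc] at h2 h3
    rw [add_div] at hσκ
    linarith
  have hW : ∀ e q p ve vq vp : ℝ, 0 ≤ ve → 0 ≤ vq → 0 ≤ vp →
      e ≤ -(σ * α) * ve + Ce / σ ^ 3 → q ≤ -(θ * β) * vq + θ * (Cq * ve) + CL / θ →
      p ≤ -m * vp + Cp * vq + Cd / σ ^ 2 →
      p + A / θ * q + B / σ * e ≤ -μ * (vp + A / θ * vq + B / σ * ve) + κ := by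
    intro e q p ve vq vp hve hvq hvp he hq hp
    have h1 : A / θ * q ≤ -(A * β) * vq + A * Cq * ve + A * (CL / θ ^ 2) :=
      (mul_le_mul_of_nonneg_left hq (by positivity)).trans_eq (by field_simp)
    have h2 : B / σ * e ≤ -(B * α) * ve + B * (Ce / σ ^ 4) :=
      (mul_le_mul_of_nonneg_left he (by positivity)).trans_eq (by field_simp)
    have h3 : μ * (A / θ * vq) ≤ vq := by
      calc μ * (A / θ * vq) ≤ 1 * (1 * vq) := by gcongr
        _ = vq := by ring
    have h4 : μ * (B / σ * ve) ≤ ve := by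
      calc μ * (B / σ * ve) ≤ 1 * (1 * ve) := by gcongr
        _ = ve := by ring
    have h5 : μ * vp ≤ m * vp := by gcongr
    rw [hAβ] at h1
    rw [hBα] at h2
    linarith
  have hinv : ∀ Ve Vq Vp, IsCascade α β m Ce Cq CL Cp Cd Re Rq Rp θ σ t₀ Ve Vq Vp →
      ∀ t, t₀ ≤ t → Ve t ≤ Re ∧ Vq t ≤ Rq ∧ Vp t + A / θ * Vq t + B / σ * Ve t ≤ Rp + 1 := by
    intro Ve Vq Vp h
    have hle : ∀ t, Vp t ≤ Vp t + A / θ * Vq t + B / σ * Ve t := fun t => by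
      have h1 := mul_nonneg (div_nonneg hA.le hθ0.le) (h.nonneg_q t)
      have h2 := mul_nonneg (div_nonneg hB.le hσ0.le) (h.nonneg_e t)
      linarith
    have := forall_le_of_deriv_neg_on_boundary (t₀ := t₀)
      (V := ![Ve, Vq, fun t => Vp t + A / θ * Vq t + B / σ * Ve t]) (c := ![Re, Rq, Rp + 1]) ?_ ?_ ?_
    · intro t ht
      exact ⟨this t ht 0, this t ht 1, this t ht 2⟩
    · intro i
      fin_cases i
      · exact h.cont_e
      · exact h.cont_q
      · exact (h.cont_p.add (h.cont_q.const_mul _)).add (h.cont_e.const_mul _)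
    · intro i
      fin_cases i
      · exact h.init_e
      · exact h.init_q
      · change Vp t₀ + A / θ * Vq t₀ + B / σ * Ve t₀ ≤ Rp + 1
        have h1 : A / θ * Vq t₀ ≤ A * Rq / θ := by
          rw [mul_div_right_comm]
          exact mul_le_mul_of_nonneg_left h.init_q (by positivity)
        have h2 : B / σ * Ve t₀ ≤ B * Re / σ := by
          rw [mul_div_right_comm]
          exact mul_le_mul_of_nonneg_left h.init_e (by positivity)
        linarith [h.init_p]
    · intro t ht hall i hi
      have he := hall 0
      have hq := hall 1
      have hp := hall 2
      simp only [Matrix.cons_val_zero, Matrix.cons_val_one, Matrix.cons_val] at he hq hp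
      obtain ⟨e, q, p, de, dq, dp, ie, iq, ip⟩ := h.deriv_le t ht he hq ((hle t).trans hp)
      fin_cases i
      · refine ⟨e, ie.trans_lt ?_, de⟩
        replace hi : Ve t = Re := hi
        rw [hi]
        have h1 := hpow _ hCe σ hσ1 3 (by norm_num)
        have h2 : α * Re ≤ σ * α * Re := by
          rw [mul_assoc]
          exact le_mul_of_one_le_left (by positivity) hσ1
        linarith
      · refine ⟨q, iq.trans_lt ?_, dq⟩
        replace hi : Vq t = Rq := hi
        rw [hi]
        have h1 : θ * (Cq * Ve t) ≤ θ * (Cq * Re) := by gcongr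
        have h2 : β * Rq - Cq * Re ≤ θ * (β * Rq - Cq * Re) := le_mul_of_one_le_left hgap.le hθ1
        linarith
      · refine ⟨p + A / θ * q + B / σ * e,
          (hW _ _ _ _ _ _ (h.nonneg_e t) (h.nonneg_q t) (h.nonneg_p t) ie iq ip).trans_lt ?_,
          (dp.add (dq.const_mul _)).add (de.const_mul _)⟩
        replace hi : Vp t + A / θ * Vq t + B / σ * Ve t = Rp + 1 := hi
        rw [hi]
        have : 0 ≤ μ * Rp := by positivity
        linarith
  have hinv' : ∀ Ve Vq Vp, IsCascade α β m Ce Cq CL Cp Cd Re Rq Rp θ σ t₀ Ve Vq Vp →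
      ∀ t, t₀ ≤ t → Ve t ≤ Re ∧ Vq t ≤ Rq ∧ Vp t ≤ Rp + 1 := by
    intro Ve Vq Vp h t ht
    obtain ⟨h1, h2, h3⟩ := hinv Ve Vq Vp h t ht
    refine ⟨h1, h2, ?_⟩
    have h4 := mul_nonneg (div_nonneg hA.le hθ0.le) (h.nonneg_q t)
    have h5 := mul_nonneg (div_nonneg hB.le hσ0.le) (h.nonneg_e t)
    linarith
  refine ⟨hinv', ?_⟩
  -- The accuracy carries `1 / σ ^ 2` because `σ ^ 2 * Ve` has to be small. `Vq` is treated only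
  -- from `T₁` on, when `Ve` is already small; `W` can be treated from `t₀`.
  obtain ⟨T₁, hT₁, hTe⟩ := exists_time_le_of_deriv_le t₀ (α := σ * α) (β := Ce / σ ^ 3) (R := Re)
    (ε := δ / 2 / σ ^ 2) (by positivity) (by positivity) (by positivity)
  obtain ⟨T₂, hT₂, hTq⟩ := exists_time_le_of_deriv_le T₁ (α := θ * β)
    (β := θ * (Cq * δ) + CL / θ) (R := Rq) (ε := ε / 3) (by positivity) (by positivity)
    (by positivity)
  obtain ⟨T₃, hT₃, hTp⟩ := exists_time_le_of_deriv_le t₀ (α := μ)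
    (β := κ) (R := Rp + 1) (ε := ε / 2) (by positivity) (by positivity) (by positivity)
  refine ⟨max T₂ T₃, hT₃.trans (le_max_right _ _), fun Ve Vq Vp h => ?_⟩
  have hex : ∀ t, ∃ e q p, t₀ ≤ t → HasDerivWithinAt Ve e (Ici t₀) t ∧
      HasDerivWithinAt Vq q (Ici t₀) t ∧ HasDerivWithinAt Vp p (Ici t₀) t ∧
      e ≤ -(σ * α) * Ve t + Ce / σ ^ 3 ∧
      q ≤ -(θ * β) * Vq t + θ * (Cq * Ve t) + CL / θ ∧
      p ≤ -m * Vp t + Cp * Vq t + Cd / σ ^ 2 := by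
    intro t
    by_cases ht : t₀ ≤ t
    · obtain ⟨h1, h2, h3⟩ := hinv' Ve Vq Vp h t ht
      obtain ⟨e, q, p, H⟩ := h.deriv_le t ht h1 h2 h3
      exact ⟨e, q, p, fun _ => H⟩
    · exact ⟨0, 0, 0, fun h => absurd h ht⟩
  choose e q p hd using hex
  have hVe : ∀ t, T₁ ≤ t → σ ^ 2 * Ve t ≤ δ := by
    intro t ht
    have h1 := hTe Ve e (fun t ht => (hd t ht).1) (fun t ht => (hd t ht).2.2.2.1) h.init_e t ht
    have h2 : σ ^ 2 * Ve t ≤ σ ^ 2 * (Ce / σ ^ 3 / (σ * α) + δ / 2 / σ ^ 2) := by gcongr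
    have h3 : σ ^ 2 * (Ce / σ ^ 3 / (σ * α) + δ / 2 / σ ^ 2) = Ce / σ ^ 2 / α + δ / 2 := by
      field_simp
    have h4 : Ce / σ ^ 2 / α ≤ δ / 2 := by
      rw [div_le_iff₀ hα]
      linarith [hpow _ hCe σ hσ1 2 (by norm_num)]
    linarith
  intro t ht
  have ht2 : T₂ ≤ t := (le_max_left _ _).trans ht
  have ht3 : T₃ ≤ t := (le_max_right _ _).trans ht
  refine ⟨(hVe t (hT₂.trans ht2)).trans hδε, ?_, ?_⟩
  · have h1 := hTq Vq q (fun t ht => (hd t (hT₁.trans ht)).2.1.mono (Ici_subset_Ici.2 hT₁)) ?_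
      (hinv' Ve Vq Vp h T₁ hT₁).2.1 t ht2
    · have h2 : (θ * (Cq * δ) + CL / θ) / (θ * β) = (Cq * δ) / β + CL / θ ^ 2 / β := by
        field_simp
      have h3 : Cq * δ / β ≤ ε / 3 := by rw [div_le_iff₀ hβ]; linarith
      have h4 : CL / θ ^ 2 / β ≤ ε / 3 := by
        rw [div_le_iff₀ hβ]
        linarith [hpow _ hCL θ hθ1 2 (by norm_num)]
      linarith
    · intro s hs
      have h2 := (hd s (hT₁.trans hs)).2.2.2.2.1
      have h3 : Ve s ≤ δ := by
        have h4 : Ve s ≤ σ ^ 2 * Ve s :=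
          le_mul_of_one_le_left (h.nonneg_e s) (one_le_pow₀ hσ1)
        exact h4.trans (hVe s hs)
      have h5 : θ * (Cq * Ve s) ≤ θ * (Cq * δ) := by gcongr
      linarith
  · have h1 := hTp (fun t => Vp t + A / θ * Vq t + B / σ * Ve t)
      (fun t => p t + A / θ * q t + B / σ * e t)
      (fun t ht => ((hd t ht).2.2.1.add ((hd t ht).2.1.const_mul _)).add
        ((hd t ht).1.const_mul _))
      (fun t ht => hW _ _ _ _ _ _ (h.nonneg_e t) (h.nonneg_q t) (h.nonneg_p t)
        (hd t ht).2.2.2.1 (hd t ht).2.2.2.2.1 (hd t ht).2.2.2.2.2)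
      (hinv Ve Vq Vp h t₀ le_rfl).2.2 t ht3
    have h2 : κ / μ ≤ ε / 2 := by rw [div_le_iff₀ hμ]; linarith
    have h4 := mul_nonneg (div_nonneg hA.le hθ0.le) (h.nonneg_q t)
    have h5 := mul_nonneg (div_nonneg hB.le hσ0.le) (h.nonneg_e t)
    linarith

/-! ### Existence and uniqueness of the Nash equilibrium. -/

theorem contDiff_ownPartial {N : ℕ} {f : Fin N → (Fin N → ℝ) → ℝ} (hf : ∀ i, ContDiff ℝ 2 (f i))
    (i : Fin N) : ContDiff ℝ 1 (ownPartial f i) :=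
  ((hf i).fderiv_right (m := 1) (by norm_num)).clm_apply contDiff_const

theorem StronglyMonotone.mul_sum_sq_le {N : ℕ} {f : Fin N → (Fin N → ℝ) → ℝ} {m : ℝ}
    (h : StronglyMonotone f m) (x z : Fin N → ℝ) :
    m * ∑ i, (x i - z i) ^ 2 ≤ ∑ i, (x i - z i) * (ownPartial f i x - ownPartial f i z) := by
  have := h x z
  rwa [EuclideanSpace.real_norm_sq_eq] at this

theorem hasDerivAt_comp_update {N : ℕ} {f : Fin N → (Fin N → ℝ) → ℝ}
    (hf : ∀ i, ContDiff ℝ 2 (f i)) (i : Fin N) (x : Fin N → ℝ) (r : ℝ) :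
    HasDerivAt (fun s => f i (Function.update x i s)) (ownPartial f i (Function.update x i r)) r :=
  (((hf i).differentiable (by norm_num)) (Function.update x i r)).hasFDerivAt.comp_hasDerivAt r
    (hasDerivAt_update x i r)

/-- Strong monotonicity applied to a unilateral deviation gives the own partial derivative the sign
of the deviation, so a stationary point is a global minimum in the player's own action by the mean
value theorem. -/
theorem isNash_iff_ownPartial_eq_zero {N : ℕ} {f : Fin N → (Fin N → ℝ) → ℝ}
    (hf : ∀ i, ContDiff ℝ 2 (f i)) {m : ℝ} (hm : 0 < m) (hmono : StronglyMonotone f m)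
    (x : Fin N → ℝ) : IsNash f x ↔ ∀ i, ownPartial f i x = 0 := by
  constructor
  · intro h i
    have h1 := hasDerivAt_comp_update hf i x (x i)
    rw [Function.update_eq_self] at h1
    refine IsLocalMin.hasDerivAt_eq_zero (Eventually.of_forall fun r => ?_) h1
    simpa using h i r
  · intro h i r
    have hmul : ∀ c, 0 ≤ (c - x i) * ownPartial f i (Function.update x i c) := by
      intro c
      have h1 := hmono.mul_sum_sq_le (Function.update x i c) x
      rw [Finset.sum_eq_single (M := ℝ) i _ (by simp), Finset.sum_eq_single (M := ℝ) i _ (by simp)]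
        at h1
      · simp only [Function.update_self, h, sub_zero] at h1
        exact (by positivity : 0 ≤ m * (c - x i) ^ 2).trans h1
      · intro j _ hj
        simp [Function.update_of_ne hj]
      · intro j _ hj
        simp [Function.update_of_ne hj]
    have hd := fun c => hasDerivAt_comp_update hf i x c
    have hcont : ∀ s : Set ℝ, ContinuousOn (fun s => f i (Function.update x i s)) s :=
      fun s c _ => (hd c).continuousAt.continuousWithinAt
    rcases lt_trichotomy r (x i) with hr | hr | hr
    · obtain ⟨c, hc, hc'⟩ := exists_hasDerivAt_eq_slope _ _ hr (hcont _) fun c _ => hd c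
      rw [Function.update_eq_self, eq_div_iff (by linarith)] at hc'
      have h1 : ownPartial f i (Function.update x i c) ≤ 0 := by
        nlinarith [hmul c, hc.2]
      nlinarith
    · rw [hr, Function.update_eq_self]
    · obtain ⟨c, hc, hc'⟩ := exists_hasDerivAt_eq_slope _ _ hr (hcont _) fun c _ => hd c
      rw [Function.update_eq_self, eq_div_iff (by linarith)] at hc'
      have h1 : 0 ≤ ownPartial f i (Function.update x i c) := by
        nlinarith [hmul c, hc.1]
      nlinarith

theorem norm_sq_le_sum_sq {ι : Type*} [Fintype ι] (x : ι → ℝ) : ‖x‖ ^ 2 ≤ ∑ i, x i ^ 2 := by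
  have h0 : 0 ≤ ∑ i, x i ^ 2 := Finset.sum_nonneg fun i _ => sq_nonneg _
  have : ‖x‖ ≤ √(∑ i, x i ^ 2) := by
    refine (pi_norm_le_iff_of_nonneg (Real.sqrt_nonneg _)).2 fun i => ?_
    refine Real.abs_le_sqrt ?_
    exact Finset.single_le_sum (f := fun i => x i ^ 2) (fun i _ => sq_nonneg _) (Finset.mem_univ i)
  calc ‖x‖ ^ 2 ≤ √(∑ i, x i ^ 2) ^ 2 := by gcongr
    _ = _ := Real.sq_sqrt h0

/-- Minimize `Φ = ∑ g i ^ 2`. At a minimizer `x` with `h = g x`, the derivative of `Φ` in the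
direction `h` is `2 ⟨h, Dg(x) h⟩ = 0`, while strong monotonicity gives `⟨h, Dg(x) h⟩ ≥ m |h|²`.
Hence `h = 0`. -/
theorem exists_forall_ownPartial_eq_zero {N : ℕ} {f : Fin N → (Fin N → ℝ) → ℝ}
    (hf : ∀ i, ContDiff ℝ 2 (f i)) {m : ℝ} (hm : 0 < m) (hmono : StronglyMonotone f m) :
    ∃ x, ∀ i, ownPartial f i x = 0 := by
  have hg := contDiff_ownPartial hf
  set Φ : (Fin N → ℝ) → ℝ := fun x => ∑ i, ownPartial f i x ^ 2 with hΦ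
  have hΦc : Continuous Φ := continuous_finsetSum _ fun i _ => (hg i).continuous.pow 2
  -- Coercivity: Young's inequality applied to `m |x|² ≤ ⟨x, g x - g 0⟩`.
  have hcoer : ∀ x, m ^ 2 / 2 * ‖x‖ ^ 2 - Φ 0 ≤ Φ x := by
    intro x
    have h1 := hmono.mul_sum_sq_le x 0
    simp only [Pi.zero_apply, sub_zero] at h1
    have h2 : ∀ i, x i * (ownPartial f i x - ownPartial f i 0) ≤
        m / 2 * x i ^ 2 + (1 / m * ownPartial f i x ^ 2 + 1 / m * ownPartial f i 0 ^ 2) := by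
      intro i
      have h3 : 0 ≤ 1 / (2 * m) * ((m * x i - (ownPartial f i x - ownPartial f i 0)) ^ 2
        + (ownPartial f i x + ownPartial f i 0) ^ 2) := by positivity
      have h4 : 1 / (2 * m) * ((m * x i - (ownPartial f i x - ownPartial f i 0)) ^ 2
          + (ownPartial f i x + ownPartial f i 0) ^ 2) = m / 2 * x i ^ 2
          + (1 / m * ownPartial f i x ^ 2 + 1 / m * ownPartial f i 0 ^ 2)
          - x i * (ownPartial f i x - ownPartial f i 0) := by
        field_simp
        ring
      linarith
    have h5 := Finset.sum_le_sum fun i (_ : i ∈ Finset.univ) => h2 i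
    rw [Finset.sum_add_distrib, Finset.sum_add_distrib, ← Finset.mul_sum, ← Finset.mul_sum,
      ← Finset.mul_sum] at h5
    have h6 : m / 2 * ∑ i, x i ^ 2 ≤ 1 / m * Φ x + 1 / m * Φ 0 := by simp only [hΦ]; linarith
    have h7 : m / 2 * ‖x‖ ^ 2 ≤ 1 / m * Φ x + 1 / m * Φ 0 :=
      (mul_le_mul_of_nonneg_left (norm_sq_le_sum_sq x) (by positivity)).trans h6
    have h8 := mul_le_mul_of_nonneg_left h7 hm.le
    have h9 : m * (1 / m * Φ x + 1 / m * Φ 0) = Φ x + Φ 0 := by field_simp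
    rw [h9] at h8
    linarith
  have htend : Tendsto Φ (cocompact _) atTop := by
    refine tendsto_atTop_mono hcoer (tendsto_atTop_add_const_right _ _ ?_)
    exact ((tendsto_pow_atTop two_ne_zero).comp
      (tendsto_norm_cocompact_atTop (E := Fin N → ℝ))).const_mul_atTop (by positivity)
  obtain ⟨x, hx⟩ := hΦc.exists_forall_le htend
  refine ⟨x, ?_⟩
  set h : Fin N → ℝ := fun i => ownPartial f i x with hh
  have hline : ∀ i, HasDerivAt (fun t : ℝ => ownPartial f i (x + t • h))
      (fderiv ℝ (ownPartial f i) x h) 0 := by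
    intro i
    have h1 : HasDerivAt (fun t : ℝ => x + t • h) h 0 := by
      simpa using ((hasDerivAt_id (0 : ℝ)).smul_const h).const_add x
    have h2 : HasFDerivAt (ownPartial f i) (fderiv ℝ (ownPartial f i) x) (x + (0 : ℝ) • h) := by
      simpa using ((hg i).differentiable (by norm_num) x).hasFDerivAt
    exact h2.comp_hasDerivAt 0 h1
  have hψ : HasDerivAt (fun t : ℝ => Φ (x + t • h))
      (∑ i, 2 * (h i * fderiv ℝ (ownPartial f i) x h)) 0 := by
    refine (HasDerivAt.fun_sum fun i _ => (hline i).fun_pow 2).congr_deriv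
      (Finset.sum_congr rfl fun i _ => ?_)
    simp [hh]
    ring
  have h0 : ∑ i, 2 * (h i * fderiv ℝ (ownPartial f i) x h) = 0 :=
    IsLocalMin.hasDerivAt_eq_zero (Eventually.of_forall fun t => by simpa using hx _) hψ
  rw [← Finset.mul_sum] at h0
  have hχ : HasDerivAt (fun t : ℝ => ∑ i, h i * ownPartial f i (x + t • h) - t * (m * ∑ i, h i ^ 2))
      (∑ i, h i * fderiv ℝ (ownPartial f i) x h - 1 * (m * ∑ i, h i ^ 2)) 0 :=
    (HasDerivAt.fun_sum fun i _ => (hline i).const_mul (h i)).sub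
      ((hasDerivAt_id (0 : ℝ)).mul_const _)
  -- Monotonicity of this function is strong monotonicity along the line `x + t h`; its derivative
  -- at `0` then bounds `⟨h, Dg(x) h⟩` from below.
  have hmon : Monotone fun t : ℝ =>
      ∑ i, h i * ownPartial f i (x + t • h) - t * (m * ∑ i, h i ^ 2) := by
    intro s t hst
    rcases hst.eq_or_lt with rfl | hst
    · rfl
    have h1 := hmono.mul_sum_sq_le (x + t • h) (x + s • h)
    have h2 : ∀ i, (x + t • h) i - (x + s • h) i = (t - s) * h i := fun i => by
      simp; ring
    simp only [h2, mul_pow, mul_assoc, ← Finset.mul_sum] at h1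
    have h3 : (t - s) * ((t - s) * (m * ∑ i, h i ^ 2)) ≤
        (t - s) * ∑ i, h i * (ownPartial f i (x + t • h) - ownPartial f i (x + s • h)) := by
      linarith
    have h4 := le_of_mul_le_mul_left h3 (sub_pos.2 hst)
    simp only [mul_sub, Finset.sum_sub_distrib] at h4
    simp only
    linarith
  have h1 := hmon.deriv_nonneg (x := 0)
  rw [hχ.deriv] at h1
  have h2 : m * ∑ i, h i ^ 2 ≤ m * 0 := by linarith
  have h3 := le_of_mul_le_mul_left h2 hm
  intro i
  have h4 : ownPartial f i x ^ 2 ≤ ∑ i, h i ^ 2 :=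
    Finset.single_le_sum (f := fun i => h i ^ 2) (fun i _ => sq_nonneg _) (Finset.mem_univ i)
  exact pow_eq_zero_iff two_ne_zero |>.1 (le_antisymm (h4.trans h3) (sq_nonneg _))

theorem existsUnique_isNash {N : ℕ} {f : Fin N → (Fin N → ℝ) → ℝ}
    (hf : ∀ i, ContDiff ℝ 2 (f i)) {m : ℝ} (hm : 0 < m) (hmono : StronglyMonotone f m) :
    ∃! x, IsNash f x := by
  simp only [isNash_iff_ownPartial_eq_zero hf hm hmono]
  obtain ⟨x, hx⟩ := exists_forall_ownPartial_eq_zero hf hm hmono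
  refine ⟨x, hx, fun z hz => ?_⟩
  have h1 := hmono.mul_sum_sq_le z x
  simp only [hz, hx, sub_zero, mul_zero, Finset.sum_const_zero] at h1
  have h2 := le_of_mul_le_mul_left (h1.trans_eq (mul_zero m).symm) hm
  funext i
  have h3 : (z i - x i) ^ 2 ≤ ∑ i, (z i - x i) ^ 2 :=
    Finset.single_le_sum (f := fun i => (z i - x i) ^ 2) (fun i _ => sq_nonneg _)
      (Finset.mem_univ i)
  exact sub_eq_zero.1 (pow_eq_zero_iff two_ne_zero |>.1 (le_antisymm (h3.trans h2) (sq_nonneg _)))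

/-! ### Uniform constants and positivity of the pinned Laplacian. -/

theorem exists_pos_forall_le {ι : Type*} [Fintype ι] {c : ι → ℝ} (hc : ∀ i, 0 < c i) :
    ∃ r > 0, ∀ i, r ≤ c i := by
  rcases isEmpty_or_nonempty ι with h | h
  · exact ⟨1, one_pos, fun i => h.elim i⟩
  · obtain ⟨i, hi⟩ := Finite.exists_min c
    exact ⟨c i, hc i, hi⟩

theorem exists_forall_le_pos {ι : Type*} [Fintype ι] (c : ι → ℝ) : ∃ r > 0, ∀ i, c i ≤ r := by
  refine ⟨∑ i, |c i| + 1, by positivity, fun i => ?_⟩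
  have := Finset.single_le_sum (f := fun i => |c i|) (fun i _ => abs_nonneg _) (Finset.mem_univ i)
  linarith [le_abs_self (c i)]

/-- By homogeneity it suffices to minimize the ratio on the compact unit sphere. -/
theorem exists_mul_sum_sq_le {ι : Type*} [Fintype ι] {φ : (ι → ℝ) → ℝ} (hc : Continuous φ)
    (hsmul : ∀ (r : ℝ) v, φ (r • v) = r ^ 2 * φ v) (hpos : ∀ v, v ≠ 0 → 0 < φ v) :
    ∃ r > 0, ∀ v, r * ∑ i, v i ^ 2 ≤ φ v := by
  have hsq : ∀ v : ι → ℝ, v ≠ 0 → 0 < ∑ i, v i ^ 2 := fun v hv =>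
    (by have := norm_pos_iff.2 hv; positivity : 0 < ‖v‖ ^ 2).trans_le (norm_sq_le_sum_sq v)
  have h0 : φ 0 = 0 := by simpa using hsmul 0 0
  rcases (Metric.sphere (0 : ι → ℝ) 1).eq_empty_or_nonempty with h | h
  · refine ⟨1, one_pos, fun v => ?_⟩
    have hv : v = 0 := by
      by_contra hv
      have : ‖v‖⁻¹ • v ∈ Metric.sphere (0 : ι → ℝ) 1 := by
        simp [norm_smul, norm_ne_zero_iff.2 hv]
      simp [h] at this
    simp [hv, h0]
  · have hne : ∀ v ∈ Metric.sphere (0 : ι → ℝ) 1, v ≠ 0 := by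
      rintro v hv rfl
      simp at hv
    obtain ⟨u, hu, hmin⟩ := (isCompact_sphere (0 : ι → ℝ) 1).exists_isMinOn h
      (f := fun v => φ v / ∑ i, v i ^ 2)
      (hc.continuousOn.div (by fun_prop) fun v hv => (hsq v (hne v hv)).ne')
    refine ⟨_, div_pos (hpos u (hne u hu)) (hsq u (hne u hu)), fun v => ?_⟩
    rcases eq_or_ne v 0 with rfl | hv
    · simp [h0]
    have hmem : ‖v‖⁻¹ • v ∈ Metric.sphere (0 : ι → ℝ) 1 := by
      simp [norm_smul, norm_ne_zero_iff.2 hv]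
    have h1 := hmin hmem
    have hn := norm_pos_iff.2 hv
    simp only [mem_ofPred_eq, hsmul, Pi.smul_apply, smul_eq_mul, mul_pow, ← Finset.mul_sum] at h1
    rw [mul_div_mul_left _ _ (by positivity), le_div_iff₀ (hsq v hv)] at h1
    exact h1

theorem IsUndirectedConnected.sum_laplacian {N : ℕ} {a : Matrix (Fin N) (Fin N) ℝ}
    (ha : IsUndirectedConnected a) (v : Fin N → ℝ) :
    ∑ i, v i * ∑ k, a i k * (v i - v k) = 1 / 2 * ∑ i, ∑ k, a i k * (v i - v k) ^ 2 := by
  have h1 : ∑ i, v i * ∑ k, a i k * (v i - v k) = ∑ i, ∑ k, v i * (a i k * (v i - v k)) :=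
    Finset.sum_congr rfl fun i _ => Finset.mul_sum _ _ _
  have h2 : ∑ i, ∑ k, v i * (a i k * (v i - v k)) = ∑ i, ∑ k, v k * (a i k * (v k - v i)) := by
    rw [Finset.sum_comm]
    exact Finset.sum_congr rfl fun i _ => Finset.sum_congr rfl fun k _ => by rw [ha.symm]
  have h3 : ∑ i, ∑ k, a i k * (v i - v k) ^ 2 =
      ∑ i, ∑ k, v i * (a i k * (v i - v k)) + ∑ i, ∑ k, v k * (a i k * (v k - v i)) := by
    rw [← Finset.sum_add_distrib]
    refine Finset.sum_congr rfl fun i _ => ?_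
    rw [← Finset.sum_add_distrib]
    exact Finset.sum_congr rfl fun k _ => by ring
  rw [h1, h3, ← h2]
  ring

theorem IsUndirectedConnected.exists_pos {N : ℕ} (hN : 2 ≤ N) {a : Matrix (Fin N) (Fin N) ℝ}
    (ha : IsUndirectedConnected a) (j : Fin N) : ∃ i, 0 < a i j := by
  have : Nontrivial (Fin N) := Fin.nontrivial_iff_two_le.2 hN
  obtain ⟨k, hk⟩ := exists_ne j
  obtain ⟨w⟩ := ha.connected.preconnected j k
  cases w with
  | nil => exact absurd rfl hk
  | @cons _ i _ hadj _ =>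
    refine ⟨i, ?_⟩
    rw [SimpleGraph.fromRel_adj] at hadj
    rcases hadj.2 with h | h
    · rwa [ha.symm]
    · exact h

/-- The form equals `½ ∑ a i k (v i - v k)² + ∑ a i j (v i)²`. If it vanishes, `v` is constant along
edges, hence constant by connectedness, and it is zero at a neighbour of `j`. The node `j` is not
pinned itself because `a j j = 0`; a neighbour exists because `N ≥ 2`. -/
theorem IsUndirectedConnected.eq_zero_of_pinned_nonpos {N : ℕ} (hN : 2 ≤ N)
    {a : Matrix (Fin N) (Fin N) ℝ} (ha : IsUndirectedConnected a) (j : Fin N) {v : Fin N → ℝ}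
    (hv : ∑ i, v i * (∑ k, a i k * (v i - v k) + a i j * v i) ≤ 0) : v = 0 := by
  have h0 : ∑ i, v i * (∑ k, a i k * (v i - v k) + a i j * v i) =
      1 / 2 * ∑ i, ∑ k, a i k * (v i - v k) ^ 2 + ∑ i, a i j * v i ^ 2 := by
    rw [← ha.sum_laplacian, ← Finset.sum_add_distrib]
    exact Finset.sum_congr rfl fun i _ => by ring
  have hn1 : ∀ i k, 0 ≤ a i k * (v i - v k) ^ 2 := fun i k =>
    mul_nonneg (ha.nonneg i k) (sq_nonneg _)
  have hn2 : ∀ i, 0 ≤ a i j * v i ^ 2 := fun i => mul_nonneg (ha.nonneg i j) (sq_nonneg _)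
  have hs1 : 0 ≤ ∑ i, ∑ k, a i k * (v i - v k) ^ 2 :=
    Finset.sum_nonneg fun i _ => Finset.sum_nonneg fun k _ => hn1 i k
  have hs2 : 0 ≤ ∑ i, a i j * v i ^ 2 := Finset.sum_nonneg fun i _ => hn2 i
  have hz1 : ∑ i, ∑ k, a i k * (v i - v k) ^ 2 = 0 := by linarith
  have hz2 : ∑ i, a i j * v i ^ 2 = 0 := by linarith
  have he : ∀ i k, 0 < a i k → v i = v k := by
    intro i k hik
    have h1 := (Finset.sum_eq_zero_iff_of_nonneg fun i _ =>
      Finset.sum_nonneg fun k _ => hn1 i k).1 hz1 i (Finset.mem_univ i)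
    have h2 := (Finset.sum_eq_zero_iff_of_nonneg fun k _ => hn1 i k).1 h1 k (Finset.mem_univ k)
    rcases mul_eq_zero.1 h2 with h3 | h3
    · exact absurd h3 hik.ne'
    · exact sub_eq_zero.1 (pow_eq_zero_iff two_ne_zero |>.1 h3)
  have hreach : ∀ i k, (SimpleGraph.fromRel fun i j => 0 < a i j).Walk i k → v i = v k := by
    intro i k w
    induction w with
    | nil => rfl
    | cons hadj _ ih =>
      rw [← ih]
      rw [SimpleGraph.fromRel_adj] at hadj
      exact hadj.2.elim (he _ _) fun h => (he _ _ h).symm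
  obtain ⟨i, hi⟩ := ha.exists_pos hN j
  have hvi : v i = 0 := by
    have h1 := (Finset.sum_eq_zero_iff_of_nonneg fun i _ => hn2 i).1 hz2 i (Finset.mem_univ i)
    rcases mul_eq_zero.1 h1 with h3 | h3
    · exact absurd h3 hi.ne'
    · exact pow_eq_zero_iff two_ne_zero |>.1 h3
  funext k
  obtain ⟨w⟩ := ha.connected.preconnected k i
  exact (hreach k i w).trans hvi

/-- The columns of `q` decouple: column `j` holds all estimates of player `j`'s action and sees the
Laplacian pinned at the neighbours of `j`. -/
theorem IsUndirectedConnected.exists_mul_sum_sq_le {N : ℕ} (hN : 2 ≤ N)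
    {a : Matrix (Fin N) (Fin N) ℝ} (ha : IsUndirectedConnected a) :
    ∃ r > 0, ∀ q : Fin N → Fin N → ℝ, r * ∑ i, ∑ j, q i j ^ 2 ≤
      ∑ i, ∑ j, q i j * (∑ k, a i k * (q i j - q k j) + a i j * q i j) := by
  have h1 : ∀ j, ∃ r > 0, ∀ v : Fin N → ℝ, r * ∑ i, v i ^ 2 ≤
      ∑ i, v i * (∑ k, a i k * (v i - v k) + a i j * v i) := by
    intro j
    refine NashPI.exists_mul_sum_sq_le (by fun_prop) (fun r v => ?_) fun v hv => ?_
    · rw [Finset.mul_sum]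
      refine Finset.sum_congr rfl fun i _ => ?_
      have : ∑ k, a i k * ((r • v) i - (r • v) k) = r * ∑ k, a i k * (v i - v k) := by
        rw [Finset.mul_sum]
        exact Finset.sum_congr rfl fun k _ => by simp; ring
      rw [this]
      simp
      ring
    · by_contra hle
      exact hv (ha.eq_zero_of_pinned_nonpos hN j (not_lt.1 hle))
  choose c hc hle using h1
  obtain ⟨r, hr, hrc⟩ := exists_pos_forall_le hc
  refine ⟨r, hr, fun q => ?_⟩
  rw [Finset.sum_comm, Finset.sum_comm (f := fun i j => q i j * _), Finset.mul_sum]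
  refine Finset.sum_le_sum fun j _ => ?_
  refine le_trans ?_ (hle j fun i => q i j)
  exact mul_le_mul_of_nonneg_right (hrc j) (Finset.sum_nonneg fun i _ => sq_nonneg _)

/-! ### Error coordinates and Lyapunov functions. -/

/-- The state `(p, q, e₁, e₂)` of the closed loop in the error coordinates `e₁ = x - x̂`,
`e₂ = (d - ẑ) / σ`, `p = x - (e₁ - (k₁ / k₂) e₂)`, `q i j = y i j - p j`. -/
abbrev ErrSpace (N : ℕ) : Type :=
  (Fin N → ℝ) × (Fin N → Fin N → ℝ) × (Fin N → ℝ) × (Fin N → ℝ)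

variable {N : ℕ}

/-- The difference `x - p`. -/
def lag (k₁ k₂ : Fin N → ℝ) (z : ErrSpace N) (j : Fin N) : ℝ :=
  z.2.2.1 j - k₁ j / k₂ j * z.2.2.2 j

/-- The velocity of the coordinate `p` when the disturbances have derivative `w`. -/
def slowField (g : Fin N → (Fin N → ℝ) → ℝ) (k₁ k₂ : Fin N → ℝ) (σ : ℝ) (w : Fin N → ℝ)
    (z : ErrSpace N) (i : Fin N) : ℝ :=
  -g i (z.1 + z.2.1 i) + k₁ i / (σ * k₂ i) * w i

/-- The closed loop in error coordinates when the disturbances have derivative `w`. -/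
def errField (g : Fin N → (Fin N → ℝ) → ℝ) (a : Matrix (Fin N) (Fin N) ℝ) (k₁ k₂ : Fin N → ℝ)
    (θbar : Fin N → Fin N → ℝ) (θ σ : ℝ) (w : Fin N → ℝ) (z : ErrSpace N) : ErrSpace N :=
  (slowField g k₁ k₂ σ w z,
   fun i j => -(θ * θbar i j) * (∑ k, a i k * (z.2.1 i j - z.2.1 k j)
      + a i j * (z.2.1 i j - lag k₁ k₂ z j)) - slowField g k₁ k₂ σ w z j,
   fun i => σ * (z.2.2.2 i - k₁ i * z.2.2.1 i),
   fun i => -(σ * k₂ i) * z.2.2.1 i + w i / σ)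

/-- Lyapunov function of the scaled observer error. -/
def lyapE (k₁ k₂ : Fin N → ℝ) (z : ErrSpace N) : ℝ :=
  ∑ i, ((2 * k₂ i * z.2.2.1 i - k₁ i * z.2.2.2 i) ^ 2
    + (4 * k₂ i + k₁ i ^ 2) * z.2.2.2 i ^ 2)

/-- Lyapunov function of the consensus error. -/
def lyapQ (θbar : Fin N → Fin N → ℝ) (z : ErrSpace N) : ℝ :=
  ∑ i, ∑ j, z.2.1 i j ^ 2 / θbar i j

/-- Lyapunov function of the distance to the equilibrium. -/
def lyapP (xs : Fin N → ℝ) (z : ErrSpace N) : ℝ :=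
  ∑ i, (z.1 i - xs i) ^ 2

theorem lyapE_nonneg {k₁ k₂ : Fin N → ℝ} (hk₂ : ∀ i, 0 < k₂ i) (z : ErrSpace N) :
    0 ≤ lyapE k₁ k₂ z :=
  Finset.sum_nonneg fun i _ => by have := hk₂ i; positivity

theorem lyapQ_nonneg {θbar : Fin N → Fin N → ℝ} (hθbar : ∀ i j, 0 < θbar i j) (z : ErrSpace N) :
    0 ≤ lyapQ θbar z :=
  Finset.sum_nonneg fun i _ => Finset.sum_nonneg fun j _ => by have := hθbar i j; positivity

theorem lyapP_nonneg (xs : Fin N → ℝ) (z : ErrSpace N) : 0 ≤ lyapP xs z :=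
  Finset.sum_nonneg fun _ _ => sq_nonneg _

@[fun_prop]
theorem continuous_lyapE (k₁ k₂ : Fin N → ℝ) : Continuous (lyapE k₁ k₂) := by
  unfold lyapE; fun_prop

@[fun_prop]
theorem continuous_lyapQ (θbar : Fin N → Fin N → ℝ) : Continuous (lyapQ θbar) := by
  unfold lyapQ; fun_prop

@[fun_prop]
theorem continuous_lyapP (xs : Fin N → ℝ) : Continuous (lyapP xs) := by
  unfold lyapP; fun_prop

theorem exists_sq_le_mul_lyapE (k₁ : Fin N → ℝ) {k₂ : Fin N → ℝ} (hk₂ : ∀ i, 0 < k₂ i) :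
    ∃ C > 0, ∀ (z : ErrSpace N) i, z.2.2.1 i ^ 2 ≤ C * lyapE k₁ k₂ z ∧
      z.2.2.2 i ^ 2 ≤ C * lyapE k₁ k₂ z ∧ lag k₁ k₂ z i ^ 2 ≤ C * lyapE k₁ k₂ z := by
  obtain ⟨A, hA, hA'⟩ := exists_forall_le_pos fun i => 1 / (2 * k₂ i ^ 2)
  obtain ⟨B, hB, hB'⟩ := exists_forall_le_pos fun i => 1 / (4 * k₂ i)
  obtain ⟨D, hD, hD'⟩ := exists_forall_le_pos fun i =>
    2 * (1 / (2 * k₂ i ^ 2)) + 2 * (k₁ i / k₂ i) ^ 2 * (1 / (4 * k₂ i))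
  refine ⟨A + B + D, by positivity, fun z i => ?_⟩
  have hk := hk₂ i
  set V := (2 * k₂ i * z.2.2.1 i - k₁ i * z.2.2.2 i) ^ 2
    + (4 * k₂ i + k₁ i ^ 2) * z.2.2.2 i ^ 2 with hV
  have hV0 : 0 ≤ V := by positivity
  have hle : V ≤ lyapE k₁ k₂ z := Finset.single_le_sum
    (f := fun i => (2 * k₂ i * z.2.2.1 i - k₁ i * z.2.2.2 i) ^ 2
      + (4 * k₂ i + k₁ i ^ 2) * z.2.2.2 i ^ 2)
    (fun i _ => by have := hk₂ i; positivity) (Finset.mem_univ i)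
  have h1 : z.2.2.1 i ^ 2 ≤ 1 / (2 * k₂ i ^ 2) * V := by
    rw [div_mul_eq_mul_div, le_div_iff₀ (by positivity)]
    nlinarith [sq_nonneg (2 * k₂ i * z.2.2.1 i - 2 * k₁ i * z.2.2.2 i),
      mul_nonneg hk.le (sq_nonneg (z.2.2.2 i))]
  have h2 : z.2.2.2 i ^ 2 ≤ 1 / (4 * k₂ i) * V := by
    rw [div_mul_eq_mul_div, le_div_iff₀ (by positivity)]
    nlinarith [sq_nonneg (2 * k₂ i * z.2.2.1 i - k₁ i * z.2.2.2 i), sq_nonneg (k₁ i * z.2.2.2 i)]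
  have h3 : lag k₁ k₂ z i ^ 2 ≤
      (2 * (1 / (2 * k₂ i ^ 2)) + 2 * (k₁ i / k₂ i) ^ 2 * (1 / (4 * k₂ i))) * V := by
    have h4 : lag k₁ k₂ z i ^ 2 ≤ 2 * z.2.2.1 i ^ 2 + 2 * (k₁ i / k₂ i) ^ 2 * z.2.2.2 i ^ 2 := by
      unfold lag
      nlinarith [sq_nonneg (z.2.2.1 i + k₁ i / k₂ i * z.2.2.2 i)]
    have h5 := mul_le_mul_of_nonneg_left h2 (by positivity : 0 ≤ 2 * (k₁ i / k₂ i) ^ 2)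
    linarith
  refine ⟨h1.trans ?_, h2.trans ?_, h3.trans ?_⟩
  · exact mul_le_mul ((hA' i).trans (by linarith)) hle hV0 (by positivity)
  · exact mul_le_mul ((hB' i).trans (by linarith)) hle hV0 (by positivity)
  · exact mul_le_mul ((hD' i).trans (by linarith)) hle hV0 (by positivity)

theorem exists_sq_le_mul_lyapQ {θbar : Fin N → Fin N → ℝ} (hθbar : ∀ i j, 0 < θbar i j) :
    ∃ C > 0, ∀ (z : ErrSpace N), ∑ i, ∑ j, z.2.1 i j ^ 2 ≤ C * lyapQ θbar z := by
  obtain ⟨C, hC, hle⟩ := exists_forall_le_pos fun ij : Fin N × Fin N => θbar ij.1 ij.2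
  refine ⟨C, hC, fun z => ?_⟩
  rw [lyapQ, Finset.mul_sum]
  refine Finset.sum_le_sum fun i _ => ?_
  rw [Finset.mul_sum]
  refine Finset.sum_le_sum fun j _ => ?_
  rw [mul_div_assoc', le_div_iff₀ (hθbar i j), mul_comm]
  exact mul_le_mul_of_nonneg_right (hle (i, j)) (sq_nonneg _)

theorem sq_le_sum_sum_sq (q : Fin N → Fin N → ℝ) (i j : Fin N) :
    q i j ^ 2 ≤ ∑ i, ∑ j, q i j ^ 2 :=
  (Finset.single_le_sum (f := fun j => q i j ^ 2) (fun _ _ => sq_nonneg _)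
    (Finset.mem_univ j)).trans
  (Finset.single_le_sum (f := fun i => ∑ j, q i j ^ 2)
    (fun _ _ => Finset.sum_nonneg fun _ _ => sq_nonneg _) (Finset.mem_univ i))

theorem sq_le_lyapP (xs : Fin N → ℝ) (z : ErrSpace N) (i : Fin N) :
    (z.1 i - xs i) ^ 2 ≤ lyapP xs z :=
  Finset.single_le_sum (f := fun i => (z.1 i - xs i) ^ 2) (fun _ _ => sq_nonneg _)
    (Finset.mem_univ i)

/-! ### Decay of the observer and consensus errors. -/

theorem hasDerivWithinAt_lyapE (k₁ k₂ : Fin N → ℝ) {γ : ℝ → ErrSpace N} {v : ErrSpace N}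
    {s : Set ℝ} {t : ℝ} (h : HasDerivWithinAt γ v s t) :
    HasDerivWithinAt (fun τ => lyapE k₁ k₂ (γ τ))
      (∑ i, (2 * (2 * k₂ i * (γ t).2.2.1 i - k₁ i * (γ t).2.2.2 i)
          * (2 * k₂ i * v.2.2.1 i - k₁ i * v.2.2.2 i)
        + (4 * k₂ i + k₁ i ^ 2) * (2 * (γ t).2.2.2 i * v.2.2.2 i))) s t := by
  have h1 := fun i => hasDerivWithinAt_pi.1 h.snd.snd.fst i
  have h2 := fun i => hasDerivWithinAt_pi.1 h.snd.snd.snd i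
  refine (HasDerivWithinAt.fun_sum fun i _ => ((((h1 i).const_mul (2 * k₂ i)).fun_sub
    ((h2 i).const_mul (k₁ i))).fun_pow 2).fun_add
    (((h2 i).fun_pow 2).const_mul (4 * k₂ i + k₁ i ^ 2))).congr_deriv
    (Finset.sum_congr rfl fun i _ => ?_)
  simp

theorem hasDerivWithinAt_lyapQ (θbar : Fin N → Fin N → ℝ) {γ : ℝ → ErrSpace N} {v : ErrSpace N}
    {s : Set ℝ} {t : ℝ} (h : HasDerivWithinAt γ v s t) :
    HasDerivWithinAt (fun τ => lyapQ θbar (γ τ))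
      (∑ i, ∑ j, 2 * (γ t).2.1 i j * v.2.1 i j / θbar i j) s t := by
  have h1 := fun i j => hasDerivWithinAt_pi.1 (hasDerivWithinAt_pi.1 h.snd.fst i) j
  refine (HasDerivWithinAt.fun_sum fun i _ => HasDerivWithinAt.fun_sum fun j _ =>
    ((h1 i j).fun_pow 2).div_const (θbar i j)).congr_deriv
    (Finset.sum_congr rfl fun i _ => Finset.sum_congr rfl fun j _ => ?_)
  simp

theorem hasDerivWithinAt_lyapP (xs : Fin N → ℝ) {γ : ℝ → ErrSpace N} {v : ErrSpace N}
    {s : Set ℝ} {t : ℝ} (h : HasDerivWithinAt γ v s t) :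
    HasDerivWithinAt (fun τ => lyapP xs (γ τ))
      (∑ i, 2 * ((γ t).1 i - xs i) * v.1 i) s t := by
  have h1 := fun i => hasDerivWithinAt_pi.1 h.fst i
  refine (HasDerivWithinAt.fun_sum fun i _ =>
    ((h1 i).sub_const (xs i)).fun_pow 2).congr_deriv (Finset.sum_congr rfl fun i _ => ?_)
  simp

/-- The quadratic form is chosen so that without `w` its derivative is `-4 σ k₁ k₂ (k₂ e₁² + e₂²)`,
with no cross term. Half of this absorbs `w` by completing squares, which leaves a remainder of
order `σ⁻³`; the other half dominates `σ α` times the form. -/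
theorem observer_deriv_le {k₁ k₂ σ α B w e₁ e₂ : ℝ} (hk₁ : 0 < k₁) (hk₂ : 0 < k₂) (hσ : 0 < σ)
    (hα₁ : 4 * α ≤ k₁) (hα₂ : α * (4 * k₂ + 3 * k₁ ^ 2) ≤ 2 * k₁ * k₂) (hα : 0 ≤ α)
    (hw : |w| ≤ B) :
    2 * (2 * k₂ * e₁ - k₁ * e₂) * (2 * k₂ * (σ * (e₂ - k₁ * e₁))
        - k₁ * (-(σ * k₂) * e₁ + w / σ))
      + (4 * k₂ + k₁ ^ 2) * (2 * e₂ * (-(σ * k₂) * e₁ + w / σ)) ≤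
    -(σ * α) * ((2 * k₂ * e₁ - k₁ * e₂) ^ 2 + (4 * k₂ + k₁ ^ 2) * e₂ ^ 2)
      + (2 * k₁ + (8 * k₂ + 4 * k₁ ^ 2) ^ 2 / (8 * k₁ * k₂)) * B ^ 2 / σ ^ 3 := by
  set C := 2 * k₁ + (8 * k₂ + 4 * k₁ ^ 2) ^ 2 / (8 * k₁ * k₂) with hC
  have hC0 : 0 ≤ C := by positivity
  have h1 : 2 * (2 * k₂ * e₁ - k₁ * e₂) * (2 * k₂ * (σ * (e₂ - k₁ * e₁))
        - k₁ * (-(σ * k₂) * e₁ + w / σ))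
      + (4 * k₂ + k₁ ^ 2) * (2 * e₂ * (-(σ * k₂) * e₁ + w / σ)) =
      -(2 * σ * k₁ * k₂ ^ 2) * (e₁ + w / (k₂ * σ ^ 2)) ^ 2
      - 2 * k₁ * k₂ * σ * (e₂ - (8 * k₂ + 4 * k₁ ^ 2) * w / (4 * k₁ * k₂ * σ ^ 2)) ^ 2
      - 2 * σ * k₁ * k₂ ^ 2 * e₁ ^ 2 - 2 * k₁ * k₂ * σ * e₂ ^ 2 + C * w ^ 2 / σ ^ 3 := by
    rw [hC]
    field_simp
    ring
  have h2 : 0 ≤ 2 * σ * k₁ * k₂ ^ 2 * (e₁ + w / (k₂ * σ ^ 2)) ^ 2 := by positivity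
  have h3 : 0 ≤ 2 * k₁ * k₂ * σ
      * (e₂ - (8 * k₂ + 4 * k₁ ^ 2) * w / (4 * k₁ * k₂ * σ ^ 2)) ^ 2 := by positivity
  have h4 : C * w ^ 2 / σ ^ 3 ≤ C * B ^ 2 / σ ^ 3 := by
    have : w ^ 2 ≤ B ^ 2 := sq_le_sq' (abs_le.1 hw).1 (abs_le.1 hw).2
    gcongr
  have h5 : α * ((2 * k₂ * e₁ - k₁ * e₂) ^ 2 + (4 * k₂ + k₁ ^ 2) * e₂ ^ 2) ≤
      2 * k₁ * k₂ ^ 2 * e₁ ^ 2 + 2 * k₁ * k₂ * e₂ ^ 2 := by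
    have h6 : α * ((2 * k₂ * e₁ - k₁ * e₂) ^ 2 + (4 * k₂ + k₁ ^ 2) * e₂ ^ 2)
        = 4 * α * (2 * k₂ ^ 2 * e₁ ^ 2) + α * (4 * k₂ + 3 * k₁ ^ 2) * e₂ ^ 2
          - α * (2 * k₂ * e₁ + k₁ * e₂) ^ 2 := by ring
    have h7 : 4 * α * (2 * k₂ ^ 2 * e₁ ^ 2) ≤ k₁ * (2 * k₂ ^ 2 * e₁ ^ 2) := by gcongr
    have h8 : α * (4 * k₂ + 3 * k₁ ^ 2) * e₂ ^ 2 ≤ 2 * k₁ * k₂ * e₂ ^ 2 := by gcongr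
    have h9 : 0 ≤ α * (2 * k₂ * e₁ + k₁ * e₂) ^ 2 := by positivity
    linarith
  have h10 := mul_le_mul_of_nonneg_left h5 hσ.le
  rw [h1]
  linarith

theorem exists_lyapE_deriv_le {k₁ k₂ : Fin N → ℝ} (hk₁ : ∀ i, 0 < k₁ i) (hk₂ : ∀ i, 0 < k₂ i)
    (B : ℝ) : ∃ α > 0, ∃ C ≥ 0, ∀ g a θbar θ σ w (z : ErrSpace N), 0 < σ → (∀ i, |w i| ≤ B) →
      ∀ v, v = errField g a k₁ k₂ θbar θ σ w z →
      (∑ i, (2 * (2 * k₂ i * z.2.2.1 i - k₁ i * z.2.2.2 i)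
          * (2 * k₂ i * v.2.2.1 i - k₁ i * v.2.2.2 i)
        + (4 * k₂ i + k₁ i ^ 2) * (2 * z.2.2.2 i * v.2.2.2 i))) ≤
      -(σ * α) * lyapE k₁ k₂ z + C / σ ^ 3 := by
  obtain ⟨α₁, h1, h1'⟩ := exists_pos_forall_le fun i => (by linarith [hk₁ i] : 0 < k₁ i / 4)
  obtain ⟨α₂, h2, h2'⟩ := exists_pos_forall_le fun i =>
    (by have := hk₁ i; have := hk₂ i; positivity :
      0 < 2 * k₁ i * k₂ i / (4 * k₂ i + 3 * k₁ i ^ 2))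
  refine ⟨min α₁ α₂, by positivity,
    ∑ i, (2 * k₁ i + (8 * k₂ i + 4 * k₁ i ^ 2) ^ 2 / (8 * k₁ i * k₂ i)) * B ^ 2,
    Finset.sum_nonneg fun i _ => by have := hk₁ i; have := hk₂ i; positivity, ?_⟩
  rintro g a θbar θ σ w z hσ hw v rfl
  rw [lyapE, Finset.mul_sum, Finset.sum_div, ← Finset.sum_add_distrib]
  refine Finset.sum_le_sum fun i _ => ?_
  have hk := hk₁ i
  have hk' := hk₂ i
  refine observer_deriv_le hk hk' hσ ?_ ?_ (by positivity) (hw i)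
  · linarith [min_le_left α₁ α₂, h1' i]
  · have := (min_le_right α₁ α₂).trans (h2' i)
    rwa [le_div_iff₀ (by positivity)] at this

/-- The weights `1 / θbar i j` cancel the individual gains, so the symmetric pinned Laplacian
appears. `β` and `Cq` precede the speed bound `K`, because the ball on which `K` is computed depends
on them. -/
theorem exists_lyapQ_deriv_le (hN : 2 ≤ N) {a : Matrix (Fin N) (Fin N) ℝ}
    (ha : IsUndirectedConnected a) (k₁ : Fin N → ℝ) {k₂ : Fin N → ℝ} (hk₂ : ∀ i, 0 < k₂ i)
    {θbar : Fin N → Fin N → ℝ} (hθbar : ∀ i j, 0 < θbar i j) :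
    ∃ β > 0, ∃ Cq ≥ 0, ∀ K, ∃ CL ≥ 0, ∀ g θ σ w (z : ErrSpace N), 0 < θ →
      (∀ i, |slowField g k₁ k₂ σ w z i| ≤ K) →
      ∀ v, v = errField g a k₁ k₂ θbar θ σ w z →
      ∑ i, ∑ j, 2 * z.2.1 i j * v.2.1 i j / θbar i j ≤
        -(θ * β) * lyapQ θbar z + θ * (Cq * lyapE k₁ k₂ z) + CL / θ := by
  obtain ⟨r, hr, hQ⟩ := ha.exists_mul_sum_sq_le hN
  obtain ⟨C, hC, hlag⟩ := exists_sq_le_mul_lyapE k₁ hk₂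
  obtain ⟨D, hD, hDle⟩ := exists_pos_forall_le fun ij : Fin N × Fin N => hθbar ij.1 ij.2
  refine ⟨r * D, by positivity, ∑ i, ∑ j, 2 * a i j ^ 2 / r * C,
    Finset.sum_nonneg fun i _ => Finset.sum_nonneg fun j _ => by positivity, fun K =>
    ⟨∑ i, ∑ j, 2 * K ^ 2 / (r * θbar i j ^ 2),
    Finset.sum_nonneg fun i _ => Finset.sum_nonneg fun j _ => by positivity, ?_⟩⟩
  rintro g θ σ w z hθ hw v rfl
  have hterm : ∀ i j, 2 * z.2.1 i j * (errField g a k₁ k₂ θbar θ σ w z).2.1 i j / θbar i j ≤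
      -(2 * θ) * (z.2.1 i j * (∑ k, a i k * (z.2.1 i j - z.2.1 k j) + a i j * z.2.1 i j))
      + θ * r * z.2.1 i j ^ 2 + θ * (2 * a i j ^ 2 / r * C * lyapE k₁ k₂ z)
      + 2 * K ^ 2 / (r * θbar i j ^ 2) / θ := by
    intro i j
    have hb := hθbar i j
    set S := ∑ k, a i k * (z.2.1 i j - z.2.1 k j)
    set q := z.2.1 i j
    set δ := lag k₁ k₂ z j
    set u := slowField g k₁ k₂ σ w z j
    have h1 : (errField g a k₁ k₂ θbar θ σ w z).2.1 i j =
      -(θ * θbar i j) * (S + a i j * (q - δ)) - u := rfl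
    -- The lag and the drift `u` of `p` are each absorbed with `θ * (r / 2) * q ^ 2`; this costs
    -- half of the `2 * θ * r` supplied by the Laplacian.
    have h2 : 2 * q * (-(θ * θbar i j) * (S + a i j * (q - δ)) - u) / θbar i j =
        -(2 * θ) * (q * (S + a i j * q)) + θ * r * q ^ 2 + θ * (2 * a i j ^ 2 / r * δ ^ 2)
        + 2 * u ^ 2 / (r * θbar i j ^ 2) / θ
        - θ * (r / 2) * (q - 2 * a i j / r * δ) ^ 2
        - θ * (r / 2) * (q + 2 * u / (r * θbar i j * θ)) ^ 2 := by
      field_simp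
      ring
    have h3 : 0 ≤ θ * (r / 2) * (q - 2 * a i j / r * δ) ^ 2 := by positivity
    have h4 : 0 ≤ θ * (r / 2) * (q + 2 * u / (r * θbar i j * θ)) ^ 2 := by positivity
    have h5 : θ * (2 * a i j ^ 2 / r * δ ^ 2) ≤
        θ * (2 * a i j ^ 2 / r * C * lyapE k₁ k₂ z) := by
      rw [mul_assoc _ C]
      have := (hlag z j).2.2
      gcongr
    have h6 : 2 * u ^ 2 / (r * θbar i j ^ 2) / θ ≤ 2 * K ^ 2 / (r * θbar i j ^ 2) / θ := by
      have : u ^ 2 ≤ K ^ 2 := sq_le_sq' (abs_le.1 (hw j)).1 (abs_le.1 (hw j)).2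
      gcongr
    rw [h1, h2]
    linarith
  have hsum := Finset.sum_le_sum fun i (_ : i ∈ Finset.univ) =>
    Finset.sum_le_sum fun j (_ : j ∈ Finset.univ) => hterm i j
  simp only [Finset.sum_add_distrib, ← Finset.mul_sum, ← Finset.sum_div, ← Finset.sum_mul]
    at hsum
  simp only [← Finset.mul_sum, ← Finset.sum_div, ← Finset.sum_mul]
    at hsum hQ ⊢
  have h1 := mul_le_mul_of_nonneg_left (hQ z.2.1) (by positivity : 0 ≤ 2 * θ)
  have h2 : r * D * lyapQ θbar z ≤ r * ∑ i, ∑ j, z.2.1 i j ^ 2 := by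
    rw [mul_assoc, lyapQ]
    refine mul_le_mul_of_nonneg_left ?_ hr.le
    simp only [Finset.mul_sum]
    refine Finset.sum_le_sum fun i _ => Finset.sum_le_sum fun j _ => ?_
    rw [mul_div_assoc', div_le_iff₀ (hθbar i j), mul_comm]
    exact mul_le_mul_of_nonneg_left (hDle (i, j)) (sq_nonneg _)
  have h3 := mul_le_mul_of_nonneg_left h2 hθ.le
  linarith

/-! ### Cut-off, global solutions and estimates on balls. -/

/-- A `C¹` map on a finite-dimensional space agrees on any ball with a bounded Lipschitz map. -/
theorem exists_lipschitzWith_bounded_eq {E F : Type*} [NormedAddCommGroup E] [NormedSpace ℝ E]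
    [FiniteDimensional ℝ E] [NormedAddCommGroup F] [NormedSpace ℝ F] {φ : E → F}
    (hφ : ContDiff ℝ 1 φ) (R : ℝ) :
    ∃ (ψ : E → F) (K : NNReal) (L : ℝ), LipschitzWith K ψ ∧ (∀ x, ‖ψ x‖ ≤ L) ∧
      ∀ x, ‖x‖ ≤ R → ψ x = φ x := by
  let χ : ContDiffBump (0 : E) := ⟨|R| + 1, |R| + 2, by positivity, by linarith⟩
  have hsupp : HasCompactSupport fun x => χ x • φ x := χ.hasCompactSupport.smul_right
  have hsm : ContDiff ℝ 1 fun x => χ x • φ x := χ.contDiff.smul hφ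
  obtain ⟨K, hK⟩ := hsm.lipschitzWith_of_hasCompactSupport hsupp one_ne_zero
  obtain ⟨L, hL⟩ := hsupp.exists_bound_of_continuous hsm.continuous
  refine ⟨_, K, L, hK, hL, fun x hx => ?_⟩
  have : χ x = 1 := χ.one_of_mem_closedBall (by
    rw [mem_closedBall_zero_iff]
    exact hx.trans ((le_abs_self R).trans (by simp [χ])))
  simp [this]

/-- A bounded time-dependent vector field, Lipschitz in space and continuous in time, has solutions
on `[t₀, ∞)`. -/
theorem exists_forall_hasDerivWithinAt_Ici {E : Type*} [NormedAddCommGroup E] [NormedSpace ℝ E]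
    [CompleteSpace E] {F : ℝ → E → E} {K : NNReal} {L : ℝ} {t₀ : ℝ}
    (hlip : ∀ t, t₀ ≤ t → LipschitzWith K (F t))
    (hcont : ∀ x, ContinuousOn (fun t => F t x) (Ici t₀))
    (hbdd : ∀ t, t₀ ≤ t → ∀ x, ‖F t x‖ ≤ L) (x₀ : E) :
    ∃ γ : ℝ → E, γ t₀ = x₀ ∧ ∀ t, t₀ ≤ t → HasDerivWithinAt γ (F t (γ t)) (Ici t₀) t := by
  have hloc : ∀ n : ℕ, ∃ γ : ℝ → E, γ t₀ = x₀ ∧ ∀ t ∈ Icc t₀ (t₀ + n),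
      HasDerivWithinAt γ (F t (γ t)) (Icc t₀ (t₀ + n)) t := by
    intro n
    -- A field bounded by `L` moves a point by at most `L * n` in time `n`, so a ball of that radius
    -- serves the whole interval.
    have hPL : IsPicardLindelof F (tmin := t₀) (tmax := t₀ + n) ⟨t₀, by simp⟩ x₀
        (L.toNNReal * n) 0 L.toNNReal K :=
      { lipschitzOnWith := fun t ht => (hlip t ht.1).lipschitzOnWith
        continuousOn := fun x _ => (hcont x).mono Icc_subset_Ici_self
        norm_le := fun t ht x _ => (hbdd t ht.1 x).trans (Real.le_coe_toNNReal L)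
        mul_max_le := by simp }
    exact hPL.exists_eq_forall_mem_Icc_hasDerivWithinAt₀
  choose γ hγ0 hγ using hloc
  have hcontγ : ∀ n, ContinuousOn (γ n) (Icc t₀ (t₀ + n)) := fun n t ht =>
    (hγ n t ht).continuousWithinAt
  have hright : ∀ n : ℕ, ∀ b ≤ t₀ + n, ∀ t ∈ Ico t₀ b,
      HasDerivWithinAt (γ n) (F t (γ n t)) (Ici t) t := by
    intro n b hb t ht
    have ht' : t ∈ Ico t₀ (t₀ + n) := ⟨ht.1, ht.2.trans_le hb⟩
    refine ((hγ n t (Ico_subset_Icc_self ht')).mono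
      (Icc_subset_Icc_left ht.1)).mono_of_mem_nhdsWithin ?_
    exact Icc_mem_nhdsGE_of_mem ⟨le_rfl, ht'.2⟩
  have heq : ∀ n m : ℕ, ∀ t, t₀ ≤ t → t ≤ t₀ + n → t ≤ t₀ + m → γ n t = γ m t := by
    intro n m t ht hn hm
    have := ODE_solution_unique_of_mem_Icc_right (v := F) (s := fun _ => univ) (K := K)
      (f := γ n) (g := γ m) (a := t₀) (b := t)
      (fun s hs => (hlip s hs.1).lipschitzOnWith)
      ((hcontγ n).mono (Icc_subset_Icc_right hn)) (hright n t hn) (fun _ _ => mem_univ _)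
      ((hcontγ m).mono (Icc_subset_Icc_right hm)) (hright m t hm) (fun _ _ => mem_univ _)
      ((hγ0 n).trans (hγ0 m).symm)
    exact this ⟨ht, le_rfl⟩
  have hceil : ∀ t, t ≤ t₀ + ⌈t - t₀⌉₊ := fun t => by linarith [Nat.le_ceil (t - t₀)]
  refine ⟨fun t => γ ⌈t - t₀⌉₊ t, hγ0 _, fun t ht => ?_⟩
  -- One more than the ceiling, so that `t` lies strictly before the right end and the derivative
  -- within `Icc` is one within `Ici t₀`.
  set n := ⌈t - t₀⌉₊ + 1 with hn
  have htn : t < t₀ + n := by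
    have := hceil t
    push_cast [hn]
    linarith
  have hΓ : ∀ s ∈ Icc t₀ (t₀ + n), γ ⌈s - t₀⌉₊ s = γ n s := fun s hs =>
    heq _ _ s hs.1 (hceil s) hs.2
  have h1 : HasDerivWithinAt (fun s => γ ⌈s - t₀⌉₊ s) (F t (γ ⌈t - t₀⌉₊ t)) (Icc t₀ (t₀ + n)) t := by
    rw [hΓ t ⟨ht, htn.le⟩]
    exact (hγ n t ⟨ht, htn.le⟩).congr hΓ (hΓ t ⟨ht, htn.le⟩)
  refine h1.mono_of_mem_nhdsWithin ?_
  rw [← Ici_inter_Iic]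
  exact inter_mem self_mem_nhdsWithin (mem_nhdsWithin_of_mem_nhds (Iic_mem_nhds htn))

theorem norm_fst_add_le {R : ℝ} {z : ErrSpace N} (hz : ‖z‖ ≤ R) (i : Fin N) :
    ‖z.1‖ ≤ 2 * R ∧ ‖z.1 + z.2.1 i‖ ≤ 2 * R := by
  have h1 : ‖z.1‖ ≤ R := (norm_fst_le z).trans hz
  have h2 : ‖z.2.1 i‖ ≤ R :=
    (norm_le_pi_norm _ i).trans ((norm_fst_le z.2).trans ((norm_snd_le z).trans hz))
  have h3 := norm_add_le z.1 (z.2.1 i)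
  have h4 := norm_nonneg z.1
  exact ⟨by linarith, by linarith⟩

theorem exists_abs_slowField_le {g : Fin N → (Fin N → ℝ) → ℝ} (hg : ∀ i, ContDiff ℝ 1 (g i))
    (k₁ k₂ : Fin N → ℝ) (R B : ℝ) :
    ∃ K, ∀ σ w (z : ErrSpace N), 1 ≤ σ → (∀ i, |w i| ≤ B) → ‖z‖ ≤ R →
      ∀ i, |slowField g k₁ k₂ σ w z i| ≤ K := by
  choose ψ _ L _ hL hψ using fun i => exists_lipschitzWith_bounded_eq (hg i) (2 * R)
  obtain ⟨L', -, hL'⟩ := exists_forall_le_pos L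
  obtain ⟨C, hC0, hC⟩ := exists_forall_le_pos fun i => |k₁ i / k₂ i|
  refine ⟨L' + C * B, fun σ w z hσ hw hz i => ?_⟩
  have h1 : |g i (z.1 + z.2.1 i)| ≤ L' := by
    rw [← hψ i _ (norm_fst_add_le hz i).2]
    exact (hL i _).trans (hL' i)
  have h2 : |k₁ i / (σ * k₂ i) * w i| ≤ C * B := by
    rw [abs_mul]
    refine mul_le_mul ?_ (hw i) (abs_nonneg _) hC0.le
    have h3 : k₁ i / (σ * k₂ i) = k₁ i / k₂ i / σ := by rw [div_div, mul_comm]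
    rw [h3, abs_div, abs_of_nonneg (by linarith : 0 ≤ σ)]
    exact (div_le_self (abs_nonneg _) hσ).trans (hC i)
  unfold slowField
  refine (abs_add_le _ _).trans ?_
  rw [abs_neg]
  linarith

/-- Strong monotonicity provides `-2 m`; the consensus error and the disturbance derivative cost `m
/ 2` each by Young's inequality, which leaves `-m`. The Lipschitz constant of the partial
derivatives is the one on the ball of radius `2 * R`. -/
theorem exists_lyapP_deriv_le {f : Fin N → (Fin N → ℝ) → ℝ} (hf : ∀ i, ContDiff ℝ 2 (f i))
    {m : ℝ} (hm : 0 < m) (hmono : StronglyMonotone f m) {xs : Fin N → ℝ}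
    (hxs : ∀ i, ownPartial f i xs = 0) (a : Matrix (Fin N) (Fin N) ℝ) (k₁ k₂ : Fin N → ℝ)
    {θbar : Fin N → Fin N → ℝ} (hθbar : ∀ i j, 0 < θbar i j) (R B : ℝ) :
    ∃ Cp ≥ 0, ∃ Cd ≥ 0, ∀ θ σ w (z : ErrSpace N), (∀ i, |w i| ≤ B) → ‖z‖ ≤ R →
      ∀ v, v = errField (ownPartial f) a k₁ k₂ θbar θ σ w z →
      ∑ i, 2 * (z.1 i - xs i) * v.1 i ≤
        -m * lyapP xs z + Cp * lyapQ θbar z + Cd / σ ^ 2 := by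
  choose ψ K _ hK _ hψ using fun i =>
    exists_lipschitzWith_bounded_eq (contDiff_ownPartial hf i) (2 * R)
  obtain ⟨K', hK0, hK'⟩ := exists_forall_le_pos fun i => (K i : ℝ)
  obtain ⟨D, hD, hDle⟩ := exists_sq_le_mul_lyapQ hθbar
  refine ⟨2 / m * K' ^ 2 * D, by positivity, ∑ i, 2 / m * (k₁ i / k₂ i) ^ 2 * B ^ 2,
    Finset.sum_nonneg fun i _ => by positivity, ?_⟩
  rintro θ σ w z hw hz v rfl
  have hlip : ∀ i, (ownPartial f i z.1 - ownPartial f i (z.1 + z.2.1 i)) ^ 2 ≤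
      K' ^ 2 * ∑ j, z.2.1 i j ^ 2 := by
    intro i
    obtain ⟨h1, h2⟩ := norm_fst_add_le hz i
    have h3 : |ownPartial f i z.1 - ownPartial f i (z.1 + z.2.1 i)| ≤ K' * ‖z.2.1 i‖ := by
      rw [← hψ i _ h1, ← hψ i _ h2, ← Real.dist_eq]
      refine ((hK i).dist_le_mul _ _).trans ?_
      rw [dist_self_add_right]
      exact mul_le_mul_of_nonneg_right (hK' i) (norm_nonneg _)
    calc _ ≤ (K' * ‖z.2.1 i‖) ^ 2 := sq_le_sq' (abs_le.1 h3).1 (abs_le.1 h3).2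
      _ = K' ^ 2 * ‖z.2.1 i‖ ^ 2 := by ring
      _ ≤ _ := by gcongr; exact norm_sq_le_sum_sq _
  have hterm : ∀ i, 2 * (z.1 i - xs i) * (errField (ownPartial f) a k₁ k₂ θbar θ σ w z).1 i ≤
      -2 * ((z.1 i - xs i) * (ownPartial f i z.1 - ownPartial f i xs)) + m * (z.1 i - xs i) ^ 2
      + 2 / m * K' ^ 2 * ∑ j, z.2.1 i j ^ 2 + 2 / m * (k₁ i / k₂ i) ^ 2 * B ^ 2 / σ ^ 2 := by
    intro i
    set r := z.1 i - xs i
    set b := ownPartial f i z.1 - ownPartial f i (z.1 + z.2.1 i)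
    set c := k₁ i / (σ * k₂ i) * w i with hc
    have h1 : (errField (ownPartial f) a k₁ k₂ θbar θ σ w z).1 i =
      -ownPartial f i (z.1 + z.2.1 i) + c := rfl
    have h2 : ∀ b : ℝ, 2 * r * b ≤ m / 2 * r ^ 2 + 2 / m * b ^ 2 := by
      intro b
      have h3 : m / 2 * r ^ 2 + 2 / m * b ^ 2 - 2 * r * b = 2 / m * (b - m / 2 * r) ^ 2 := by
        field_simp
        ring
      have h4 : 0 ≤ 2 / m * (b - m / 2 * r) ^ 2 := by positivity
      linarith
    have h5 : 2 / m * c ^ 2 ≤ 2 / m * (k₁ i / k₂ i) ^ 2 * B ^ 2 / σ ^ 2 := by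
      have h6 : w i ^ 2 ≤ B ^ 2 := sq_le_sq' (abs_le.1 (hw i)).1 (abs_le.1 (hw i)).2
      have h7 : c ^ 2 = (k₁ i / k₂ i) ^ 2 * w i ^ 2 / σ ^ 2 := by
        rw [hc, mul_comm σ, ← div_div]
        ring
      rw [h7, mul_div_assoc', ← mul_assoc]
      gcongr
    have h8 := mul_le_mul_of_nonneg_left (hlip i) (by positivity : 0 ≤ 2 / m)
    rw [h1, hxs i, sub_zero]
    linarith [h2 b, h2 c]
  have hsum := Finset.sum_le_sum fun i (_ : i ∈ Finset.univ) => hterm i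
  simp only [Finset.sum_add_distrib, ← Finset.mul_sum, ← Finset.sum_div] at hsum
  have h1 := hmono.mul_sum_sq_le z.1 xs
  have h2 := mul_le_mul_of_nonneg_left (hDle z) (by positivity : 0 ≤ 2 / m * K' ^ 2)
  simp only [lyapP, Finset.sum_div] at hsum ⊢
  linarith

/-- The contribution of the derivatives of the disturbances to the field `errField`. -/
def forcing (k₁ k₂ : Fin N → ℝ) (σ : ℝ) (w : Fin N → ℝ) : ErrSpace N :=
  (fun i => k₁ i / (σ * k₂ i) * w i, fun _ j => -(k₁ j / (σ * k₂ j) * w j), 0, fun i => w i / σ)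

/-- Only the autonomous part needs a cut-off in space; the forcing is independent of the state, and
continuous and bounded in time. -/
theorem errField_eq_add_forcing (g : Fin N → (Fin N → ℝ) → ℝ) (a : Matrix (Fin N) (Fin N) ℝ)
    (k₁ k₂ : Fin N → ℝ) (θbar : Fin N → Fin N → ℝ) (θ σ : ℝ) (w : Fin N → ℝ) (z : ErrSpace N) :
    errField g a k₁ k₂ θbar θ σ w z =
      errField g a k₁ k₂ θbar θ σ 0 z + forcing k₁ k₂ σ w := by
  refine Prod.ext ?_ (Prod.ext ?_ (Prod.ext ?_ ?_))
  · funext i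
    simp [errField, slowField, forcing]
  · funext i j
    simp [errField, slowField, forcing]
    ring
  · simp [errField, forcing]
  · funext i
    simp [errField, forcing]

theorem contDiff_errField {g : Fin N → (Fin N → ℝ) → ℝ} (hg : ∀ i, ContDiff ℝ 1 (g i))
    (a : Matrix (Fin N) (Fin N) ℝ) (k₁ k₂ : Fin N → ℝ) (θbar : Fin N → Fin N → ℝ) (θ σ : ℝ)
    (w : Fin N → ℝ) : ContDiff ℝ 1 (errField g a k₁ k₂ θbar θ σ w) := by
  have hp : ∀ i, ContDiff ℝ 1 fun z : ErrSpace N => z.1 i := fun i =>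
    (contDiff_apply ℝ ℝ i).comp contDiff_fst
  have hq' : ∀ i, ContDiff ℝ 1 fun z : ErrSpace N => z.2.1 i := fun i =>
    (contDiff_apply ℝ (Fin N → ℝ) i).comp (contDiff_fst.comp contDiff_snd)
  have hq : ∀ i j, ContDiff ℝ 1 fun z : ErrSpace N => z.2.1 i j := fun i j =>
    (contDiff_apply ℝ ℝ j).comp (hq' i)
  have he₁ : ∀ i, ContDiff ℝ 1 fun z : ErrSpace N => z.2.2.1 i := fun i =>
    (contDiff_apply ℝ ℝ i).comp (contDiff_fst.comp (contDiff_snd.comp contDiff_snd))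
  have he₂ : ∀ i, ContDiff ℝ 1 fun z : ErrSpace N => z.2.2.2 i := fun i =>
    (contDiff_apply ℝ ℝ i).comp (contDiff_snd.comp (contDiff_snd.comp contDiff_snd))
  have hlag : ∀ j, ContDiff ℝ 1 fun z : ErrSpace N => lag k₁ k₂ z j := fun j =>
    (he₁ j).sub (contDiff_const.mul (he₂ j))
  have hs : ∀ i, ContDiff ℝ 1 fun z : ErrSpace N => slowField g k₁ k₂ σ w z i := fun i =>
    ((hg i).comp (contDiff_fst.add (hq' i))).neg.add contDiff_const
  refine (contDiff_pi.2 hs).prodMk (ContDiff.prodMk ?_ (ContDiff.prodMk ?_ ?_))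
  · refine contDiff_pi.2 fun i => contDiff_pi.2 fun j => ContDiff.sub (contDiff_const.mul ?_) (hs j)
    exact (ContDiff.sum fun k _ => contDiff_const.mul ((hq i j).sub (hq k j))).add
      (contDiff_const.mul ((hq i j).sub (hlag j)))
  · exact contDiff_pi.2 fun i => contDiff_const.mul ((he₂ i).sub (contDiff_const.mul (he₁ i)))
  · exact contDiff_pi.2 fun i => (contDiff_const.mul (he₁ i)).add contDiff_const

theorem continuous_forcing (k₁ k₂ : Fin N → ℝ) (σ : ℝ) : Continuous (forcing k₁ k₂ σ) := by
  unfold forcing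
  fun_prop

/-- The error dynamics, cut off outside of a ball, have solutions on `[t₀, ∞)`. -/
theorem exists_cutoff_solution {g : Fin N → (Fin N → ℝ) → ℝ} (hg : ∀ i, ContDiff ℝ 1 (g i))
    (a : Matrix (Fin N) (Fin N) ℝ) (k₁ k₂ : Fin N → ℝ) (θbar : Fin N → Fin N → ℝ) (θ σ : ℝ)
    {t₀ B : ℝ} {w : Fin N → ℝ → ℝ} (hw : ∀ i, ContinuousOn (w i) (Ici t₀))
    (hB : ∀ t, t₀ ≤ t → ∀ i, |w i t| ≤ B) (R : ℝ) (z₀ : ErrSpace N) :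
    ∃ γ : ℝ → ErrSpace N, γ t₀ = z₀ ∧ ContinuousOn γ (Ici t₀) ∧ ∀ t, t₀ ≤ t → ‖γ t‖ ≤ R →
      HasDerivWithinAt γ (errField g a k₁ k₂ θbar θ σ (fun i => w i t) (γ t)) (Ici t₀) t := by
  obtain ⟨ψ, K, L, hK, hL, hψ⟩ :=
    exists_lipschitzWith_bounded_eq (contDiff_errField hg a k₁ k₂ θbar θ σ 0) R
  obtain ⟨L', hL'⟩ := (isCompact_closedBall (0 : Fin N → ℝ) |B|).exists_bound_of_continuousOn
    (continuous_forcing k₁ k₂ σ).continuousOn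
  have hwc : ContinuousOn (fun t i => w i t) (Ici t₀) := continuousOn_pi.2 hw
  obtain ⟨γ, h0, hγ⟩ := exists_forall_hasDerivWithinAt_Ici (K := K) (L := L + L') (t₀ := t₀)
    (F := fun t z => ψ z + forcing k₁ k₂ σ fun i => w i t)
    (fun t _ => LipschitzWith.of_dist_le_mul fun x y => by
      rw [dist_add_right]
      exact hK.dist_le_mul x y)
    (fun x => continuousOn_const.add ((continuous_forcing k₁ k₂ σ).comp_continuousOn hwc))
    (fun t ht x => (norm_add_le _ _).trans (add_le_add (hL x) (hL' _ (by
      rw [mem_closedBall_zero_iff]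
      refine (pi_norm_le_iff_of_nonneg (abs_nonneg B)).2 fun i => ?_
      exact (hB t ht i).trans (le_abs_self B))))) z₀
  refine ⟨γ, h0, fun t ht => (hγ t ht).continuousWithinAt, fun t ht hR => ?_⟩
  rw [errField_eq_add_forcing, ← hψ _ hR]
  exact hγ t ht

/-! ### Passage between the closed loop and the error coordinates. -/

/-- The error coordinates of a state when the disturbances take the values `c`. -/
def toErr (k₁ k₂ : Fin N → ℝ) (σ : ℝ) (c : Fin N → ℝ) (s : State N) : ErrSpace N :=
  let p : Fin N → ℝ := fun j =>
    s.x j - ((s.x j - s.xhat j) - k₁ j / k₂ j * ((c j - s.zhat j) / σ))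
  (p, fun i j => s.y i j - p j, fun i => s.x i - s.xhat i, fun i => (c i - s.zhat i) / σ)

/-- The state with given error coordinates when the disturbances take the values `c`. -/
def ofErr (k₁ k₂ : Fin N → ℝ) (σ : ℝ) (c : Fin N → ℝ) (z : ErrSpace N) : State N where
  x i := z.1 i + lag k₁ k₂ z i
  y i j := z.1 j + z.2.1 i j
  xhat i := z.1 i + lag k₁ k₂ z i - z.2.2.1 i
  zhat i := c i - σ * z.2.2.2 i

theorem ofErr_toErr (k₁ k₂ : Fin N → ℝ) {σ : ℝ} (hσ : 0 < σ) (c : Fin N → ℝ) (s : State N) :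
    ofErr k₁ k₂ σ c (toErr k₁ k₂ σ c s) = s := by
  obtain ⟨x, y, xhat, zhat⟩ := s
  simp only [ofErr, toErr, lag, State.mk.injEq]
  refine ⟨?_, ?_, ?_, ?_⟩
  · funext i; ring
  · funext i j; ring
  · funext i; ring
  · funext i; field_simp; ring

section Trajectories

variable {f : Fin N → (Fin N → ℝ) → ℝ} {a : Matrix (Fin N) (Fin N) ℝ} {t₀ : ℝ}
  {d : Fin N → ℝ → ℝ} {k₁ k₂ : Fin N → ℝ} {θbar : Fin N → Fin N → ℝ} {θ σ : ℝ}

/-- The terms in `σ e₂` and `σ k₁ e₁` cancel in the derivative of `p`. -/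
theorem IsSolution.hasDerivWithinAt_toErr {s : ℝ → State N}
    (hs : IsSolution f a t₀ d k₁ k₂ θbar θ σ s) {w : Fin N → ℝ → ℝ}
    (hd : ∀ i t, t₀ ≤ t → HasDerivWithinAt (d i) (w i t) (Ici t₀) t)
    (hk₂ : ∀ i, 0 < k₂ i) (hσ : 0 < σ) {t : ℝ} (ht : t₀ ≤ t) :
    HasDerivWithinAt (fun τ => toErr k₁ k₂ σ (fun i => d i τ) (s τ))
      (errField (ownPartial f) a k₁ k₂ θbar θ σ (fun i => w i t)
        (toErr k₁ k₂ σ (fun i => d i t) (s t))) (Ici t₀) t := by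
  have he₁ : ∀ i, HasDerivWithinAt (fun τ => (s τ).x i - (s τ).xhat i)
      (σ * ((d i t - (s t).zhat i) / σ - k₁ i * ((s t).x i - (s t).xhat i))) (Ici t₀) t :=
    fun i => ((hs.ode_x i t ht).sub (hs.ode_xhat i t ht)).congr_deriv (by field_simp; ring)
  have he₂ : ∀ i, HasDerivWithinAt (fun τ => (d i τ - (s τ).zhat i) / σ)
      (-(σ * k₂ i) * ((s t).x i - (s t).xhat i) + w i t / σ) (Ici t₀) t :=
    fun i => (((hd i t ht).sub (hs.ode_zhat i t ht)).div_const σ).congr_deriv (by field_simp; ring)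
  have harg : ∀ i, (toErr k₁ k₂ σ (fun i => d i t) (s t)).1
      + (toErr k₁ k₂ σ (fun i => d i t) (s t)).2.1 i = (s t).y i := by
    intro i
    funext j
    simp [toErr]
  have hp : ∀ j, HasDerivWithinAt (fun τ => (s τ).x j - (((s τ).x j - (s τ).xhat j)
      - k₁ j / k₂ j * ((d j τ - (s τ).zhat j) / σ)))
      (slowField (ownPartial f) k₁ k₂ σ (fun i => w i t)
        (toErr k₁ k₂ σ (fun i => d i t) (s t)) j) (Ici t₀) t := by
    intro j
    refine ((hs.ode_x j t ht).sub ((he₁ j).sub ((he₂ j).const_mul (k₁ j / k₂ j)))).congr_deriv ?_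
    have := hk₂ j
    rw [slowField, harg, control]
    field_simp
    ring
  refine (hasDerivWithinAt_pi.2 hp).prodMk (HasDerivWithinAt.prodMk ?_
    ((hasDerivWithinAt_pi.2 he₁).prodMk (hasDerivWithinAt_pi.2 he₂)))
  refine hasDerivWithinAt_pi.2 fun i => hasDerivWithinAt_pi.2 fun j => ?_
  refine ((hs.ode_y i j t ht).sub (hp j)).congr_deriv ?_
  simp only [toErr, lag]
  congr 3
  · exact Finset.sum_congr rfl fun k _ => by ring
  · ring

theorem isSolution_ofErr {w : Fin N → ℝ → ℝ}
    (hd : ∀ i t, t₀ ≤ t → HasDerivWithinAt (d i) (w i t) (Ici t₀) t)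
    (hk₂ : ∀ i, 0 < k₂ i) (hσ : 0 < σ) {γ : ℝ → ErrSpace N}
    (hγ : ∀ t, t₀ ≤ t → HasDerivWithinAt γ
      (errField (ownPartial f) a k₁ k₂ θbar θ σ (fun i => w i t) (γ t)) (Ici t₀) t) :
    IsSolution f a t₀ d k₁ k₂ θbar θ σ fun t => ofErr k₁ k₂ σ (fun i => d i t) (γ t) := by
  have hp := fun i t ht => hasDerivWithinAt_pi.1 (hγ t ht).fst i
  have hq := fun i j t ht => hasDerivWithinAt_pi.1 (hasDerivWithinAt_pi.1 (hγ t ht).snd.fst i) j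
  have he₁ := fun i t ht => hasDerivWithinAt_pi.1 (hγ t ht).snd.snd.fst i
  have he₂ := fun i t ht => hasDerivWithinAt_pi.1 (hγ t ht).snd.snd.snd i
  have hx : ∀ i, ∀ t ∈ Ici t₀, HasDerivWithinAt
      (fun τ => (ofErr k₁ k₂ σ (fun i => d i τ) (γ τ)).x i)
      (control f (ofErr k₁ k₂ σ (fun i => d i t) (γ t)) i + d i t) (Ici t₀) t := by
    intro i t ht
    refine ((hp i t ht).add ((he₁ i t ht).sub ((he₂ i t ht).const_mul (k₁ i / k₂ i)))).congr_deriv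
      ?_
    have := hk₂ i
    have harg : (ofErr k₁ k₂ σ (fun i => d i t) (γ t)).y i = (γ t).1 + (γ t).2.1 i := rfl
    rw [control, harg]
    simp only [errField, slowField, ofErr]
    field_simp
    ring
  refine ⟨hx, fun i j t ht => ?_, fun i t ht => ?_, fun i t ht => ?_⟩
  · refine ((hp j t ht).add (hq i j t ht)).congr_deriv ?_
    simp only [errField, ofErr]
    rw [add_sub_cancel]
    congr 2
    · exact Finset.sum_congr rfl fun k _ => by ring
    · ring
  · refine ((hx i t ht).sub (he₁ i t ht)).congr_deriv ?_
    simp only [errField, ofErr]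
    ring
  · refine ((hd i t ht).sub ((he₂ i t ht).const_mul σ)).congr_deriv ?_
    simp only [errField, ofErr]
    field_simp
    ring

end Trajectories

/-! ### Comparison of the error norm with the Lyapunov functions. -/

theorem abs_le_norm_errorVec (xs c : Fin N → ℝ) (s : State N) :
    (∀ i, |s.x i - s.xhat i| ≤ ‖errorVec xs c s‖) ∧ (∀ i, |c i - s.zhat i| ≤ ‖errorVec xs c s‖) ∧
    (∀ i j, |s.y i j - s.x j| ≤ ‖errorVec xs c s‖) ∧ ∀ i, |s.x i - xs i| ≤ ‖errorVec xs c s‖ :=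
  ⟨fun i => PiLp.norm_apply_le (errorVec xs c s) (.inl (.inl i)),
   fun i => PiLp.norm_apply_le (errorVec xs c s) (.inl (.inr i)),
   fun i j => PiLp.norm_apply_le (errorVec xs c s) (.inr (.inl (i, j))),
   fun i => PiLp.norm_apply_le (errorVec xs c s) (.inr (.inr i))⟩

theorem norm_errorVec_sq_le {xs c : Fin N → ℝ} {s : State N} {b : ℝ}
    (h₁ : ∀ i, (s.x i - s.xhat i) ^ 2 ≤ b) (h₂ : ∀ i, (c i - s.zhat i) ^ 2 ≤ b)
    (h₃ : ∀ i j, (s.y i j - s.x j) ^ 2 ≤ b) (h₄ : ∀ i, (s.x i - xs i) ^ 2 ≤ b) :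
    ‖errorVec xs c s‖ ^ 2 ≤
      Fintype.card ((Fin N ⊕ Fin N) ⊕ ((Fin N × Fin N) ⊕ Fin N)) * b := by
  rw [EuclideanSpace.real_norm_sq_eq, ← nsmul_eq_mul]
  refine Finset.sum_le_card_nsmul _ _ _ ?_
  rintro ((i | i) | (ij | i)) -
  · exact h₁ i
  · exact h₂ i
  · exact h₃ ij.1 ij.2
  · exact h₄ i

/-- `R` does not depend on `σ`: for `σ ≥ 1` the scaling in `e₂` only shrinks the initial error, so
the levels can be fixed before the gains. -/
theorem exists_norm_toErr_le (k₁ k₂ xs : Fin N → ℝ) {v : ℝ} (hv : 0 ≤ v) :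
    ∃ R, ∀ σ c (s : State N), 1 ≤ σ → ‖errorVec xs c s‖ ≤ v → ‖toErr k₁ k₂ σ c s‖ ≤ R := by
  obtain ⟨C, hC, hCle⟩ := exists_forall_le_pos fun i => |k₁ i / k₂ i|
  refine ⟨‖xs‖ + (2 * v + C * v), fun σ c s hσ hs => ?_⟩
  obtain ⟨h₁, h₂, h₃, h₄⟩ := abs_le_norm_errorVec xs c s
  have hxs := norm_nonneg xs
  have hCv : 0 ≤ C * v := by positivity
  have he₂ : ∀ i, |(c i - s.zhat i) / σ| ≤ v := fun i => by
    rw [abs_div, abs_of_nonneg (by linarith : 0 ≤ σ)]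
    exact (div_le_self (abs_nonneg _) hσ).trans ((h₂ i).trans hs)
  have hlag : ∀ j, |(s.x j - s.xhat j) - k₁ j / k₂ j * ((c j - s.zhat j) / σ)| ≤ v + C * v := by
    intro j
    refine (abs_sub _ _).trans (add_le_add ((h₁ j).trans hs) ?_)
    rw [abs_mul]
    exact mul_le_mul (hCle j) (he₂ j) (abs_nonneg _) hC.le
  have hR : 0 ≤ ‖xs‖ + (2 * v + C * v) := by positivity
  refine norm_prod_le_iff.2 ⟨?_, norm_prod_le_iff.2 ⟨?_, norm_prod_le_iff.2 ⟨?_, ?_⟩⟩⟩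
  · refine (pi_norm_le_iff_of_nonneg hR).2 fun i => ?_
    have h := abs_le.1 (hlag i)
    have h' := abs_le.1 ((h₄ i).trans hs)
    have hx := abs_le.1 (norm_le_pi_norm xs i)
    simp only [toErr, Real.norm_eq_abs]
    exact abs_le.2 ⟨by linarith, by linarith⟩
  · refine (pi_norm_le_iff_of_nonneg hR).2 fun i => (pi_norm_le_iff_of_nonneg hR).2 fun j => ?_
    have h := abs_le.1 (hlag j)
    have h' := abs_le.1 ((h₃ i j).trans hs)
    simp only [toErr, Real.norm_eq_abs]
    exact abs_le.2 ⟨by linarith, by linarith⟩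
  · refine (pi_norm_le_iff_of_nonneg hR).2 fun i => ((h₁ i).trans hs).trans (by linarith)
  · refine (pi_norm_le_iff_of_nonneg hR).2 fun i => (he₂ i).trans (by linarith)

theorem exists_lyap_le (k₁ k₂ xs : Fin N → ℝ) (θbar : Fin N → Fin N → ℝ) (R : ℝ) :
    ∃ M > 0, ∀ z : ErrSpace N, ‖z‖ ≤ R → lyapE k₁ k₂ z ≤ M ∧ lyapQ θbar z ≤ M ∧ lyapP xs z ≤ M := by
  have hK := isCompact_closedBall (0 : ErrSpace N) R
  obtain ⟨A, hA⟩ := hK.exists_bound_of_continuousOn (continuous_lyapE k₁ k₂).continuousOn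
  obtain ⟨B, hB⟩ := hK.exists_bound_of_continuousOn (continuous_lyapQ θbar).continuousOn
  obtain ⟨C, hC⟩ := hK.exists_bound_of_continuousOn (continuous_lyapP xs).continuousOn
  refine ⟨|A| + |B| + |C| + 1, by positivity, fun z hz => ?_⟩
  have hz' : z ∈ Metric.closedBall (0 : ErrSpace N) R := mem_closedBall_zero_iff.2 hz
  have h₁ := (le_abs_self _).trans (hA z hz')
  have h₂ := (le_abs_self _).trans (hB z hz')
  have h₃ := (le_abs_self _).trans (hC z hz')
  have := le_abs_self A
  have := le_abs_self B
  have := le_abs_self C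
  have := abs_nonneg A
  have := abs_nonneg B
  have := abs_nonneg C
  exact ⟨by linarith, by linarith, by linarith⟩

theorem exists_norm_le_of_lyap_le (k₁ xs : Fin N → ℝ) {k₂ : Fin N → ℝ}
    {θbar : Fin N → Fin N → ℝ} (hk₂ : ∀ i, 0 < k₂ i) (hθbar : ∀ i j, 0 < θbar i j) (M : ℝ) :
    ∃ R, ∀ z : ErrSpace N, lyapE k₁ k₂ z ≤ M → lyapQ θbar z ≤ M → lyapP xs z ≤ M → ‖z‖ ≤ R := by
  obtain ⟨C, hC, hE⟩ := exists_sq_le_mul_lyapE k₁ hk₂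
  obtain ⟨D, hD, hQ⟩ := exists_sq_le_mul_lyapQ hθbar
  refine ⟨√(C * M) + √(D * M) + (‖xs‖ + √M), fun z h₁ h₂ h₃ => ?_⟩
  have hs1 := Real.sqrt_nonneg (C * M)
  have hs2 := Real.sqrt_nonneg (D * M)
  have hs3 := Real.sqrt_nonneg M
  have hxs := norm_nonneg xs
  have hCM : C * lyapE k₁ k₂ z ≤ C * M := by gcongr
  have hR : 0 ≤ √(C * M) + √(D * M) + (‖xs‖ + √M) := by positivity
  refine norm_prod_le_iff.2 ⟨?_, norm_prod_le_iff.2 ⟨?_, norm_prod_le_iff.2 ⟨?_, ?_⟩⟩⟩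
  · refine (pi_norm_le_iff_of_nonneg hR).2 fun i => ?_
    have h := abs_le.1 (Real.abs_le_sqrt ((sq_le_lyapP xs z i).trans h₃))
    have hx := abs_le.1 (norm_le_pi_norm xs i)
    exact abs_le.2 ⟨by linarith, by linarith⟩
  · refine (pi_norm_le_iff_of_nonneg hR).2 fun i => (pi_norm_le_iff_of_nonneg hR).2 fun j => ?_
    have h := Real.abs_le_sqrt ((sq_le_sum_sum_sq z.2.1 i j).trans
      ((hQ z).trans (by gcongr : D * lyapQ θbar z ≤ D * M)))
    exact h.trans (by linarith)
  · refine (pi_norm_le_iff_of_nonneg hR).2 fun i => ?_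
    exact (Real.abs_le_sqrt ((hE z i).1.trans hCM)).trans (by linarith)
  · refine (pi_norm_le_iff_of_nonneg hR).2 fun i => ?_
    exact (Real.abs_le_sqrt ((hE z i).2.1.trans hCM)).trans (by linarith)

/-- The factor `σ ^ 2` controls `d - ẑ = σ e₂`; the other errors follow from `y - x = q - lag` and
`x - xs = (p - xs) + lag`. -/
theorem exists_norm_errorVec_le (k₁ xs : Fin N → ℝ) {k₂ : Fin N → ℝ}
    {θbar : Fin N → Fin N → ℝ} (hk₂ : ∀ i, 0 < k₂ i) (hθbar : ∀ i j, 0 < θbar i j) {v : ℝ}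
    (hv : 0 < v) :
    ∃ ε > 0, ∀ σ c (s : State N), 1 ≤ σ → ∀ z, z = toErr k₁ k₂ σ c s →
      σ ^ 2 * lyapE k₁ k₂ z ≤ ε → lyapQ θbar z ≤ ε → lyapP xs z ≤ ε → ‖errorVec xs c s‖ ≤ v := by
  obtain ⟨C, hC, hE⟩ := exists_sq_le_mul_lyapE k₁ hk₂
  obtain ⟨D, hD, hQ⟩ := exists_sq_le_mul_lyapQ hθbar
  set n : ℝ := ((Fintype.card ((Fin N ⊕ Fin N) ⊕ ((Fin N × Fin N) ⊕ Fin N)) : ℕ) : ℝ) with hn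
  have hn0 : 0 ≤ n := Nat.cast_nonneg _
  obtain ⟨ε, hε, hεv⟩ : ∃ ε > 0, n * ((2 + 2 * C + 2 * D) * ε) ≤ v ^ 2 := by
    refine ⟨v ^ 2 / ((n + 1) * (2 + 2 * C + 2 * D)), by positivity, ?_⟩
    have : n * ((2 + 2 * C + 2 * D) * (v ^ 2 / ((n + 1) * (2 + 2 * C + 2 * D)))) =
        n / (n + 1) * v ^ 2 := by field_simp
    rw [this]
    exact mul_le_of_le_one_left (sq_nonneg v) ((div_le_one (by positivity)).2 (by linarith))
  refine ⟨ε, hε, ?_⟩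
  rintro σ c s hσ z rfl h₁ h₂ h₃
  set z := toErr k₁ k₂ σ c s with hz
  have hσ0 : 0 < σ := by linarith
  have h₁' : lyapE k₁ k₂ z ≤ ε :=
    (le_mul_of_one_le_left (lyapE_nonneg hk₂ z) (one_le_pow₀ hσ)).trans h₁
  have hCε : C * lyapE k₁ k₂ z ≤ C * ε := by gcongr
  have hDε : D * lyapQ θbar z ≤ D * ε := by gcongr
  have hCε0 : 0 < C * ε := by positivity
  have hDε0 : 0 < D * ε := by positivity
  have key : ‖errorVec xs c s‖ ^ 2 ≤ n * ((2 + 2 * C + 2 * D) * ε) := by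
    refine norm_errorVec_sq_le (fun i => ?_) (fun i => ?_) (fun i j => ?_) fun i => ?_
    · exact ((hE z i).1.trans hCε).trans (by linarith)
    · have h4 : (c i - s.zhat i) ^ 2 = σ ^ 2 * z.2.2.2 i ^ 2 := by
        rw [← mul_pow]
        congr 1
        simp only [hz, toErr]
        field_simp
      have h5 := mul_le_mul_of_nonneg_left (hE z i).2.1 (sq_nonneg σ)
      have h6 := mul_le_mul_of_nonneg_left h₁ hC.le
      rw [h4]
      linarith
    · have h4 : s.y i j - s.x j = z.2.1 i j - lag k₁ k₂ z j := by
        simp only [hz, toErr, lag]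
        ring
      have h5 := (sq_le_sum_sum_sq z.2.1 i j).trans ((hQ z).trans hDε)
      have h6 := (hE z j).2.2.trans hCε
      rw [h4]
      linarith [sq_nonneg (z.2.1 i j + lag k₁ k₂ z j)]
    · have h4 : s.x i - xs i = (z.1 i - xs i) + lag k₁ k₂ z i := by
        simp only [hz, toErr, lag]
        ring
      have h5 := (sq_le_lyapP xs z i).trans h₃
      have h6 := (hE z i).2.2.trans hCε
      rw [h4]
      linarith [sq_nonneg ((z.1 i - xs i) - lag k₁ k₂ z i)]
  exact (sq_le_sq₀ (norm_nonneg _) hv.le).1 (key.trans hεv)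

/-! ### Choice of the gains and conclusion. -/

theorem exists_disturbance_bound {t₀ : ℝ} {d : Fin N → ℝ → ℝ}
    (hd : ∀ i, IsAdmissibleDisturbance t₀ (d i)) :
    ∃ (w : Fin N → ℝ → ℝ) (B : ℝ), (∀ i, ContinuousOn (w i) (Ici t₀)) ∧
      (∀ t, t₀ ≤ t → ∀ i, |w i t| ≤ B) ∧
      ∀ i t, t₀ ≤ t → HasDerivWithinAt (d i) (w i t) (Ici t₀) t := by
  choose hc b hb using hd
  obtain ⟨B, -, hB⟩ := exists_forall_le_pos b
  refine ⟨fun i => derivWithin (d i) (Ici t₀), B, fun i => ?_, fun t ht i => ?_, fun i t ht => ?_⟩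
  · exact (hc i).continuousOn_derivWithin (uniqueDiffOn_Ici t₀) le_rfl
  · exact (hb i t ht).trans (hB i)
  · exact ((hc i).differentiableOn one_ne_zero t ht).hasDerivWithinAt

/-- Semiglobal practical stability of the error dynamics: trajectories starting in a given ball
stay bounded and enter every neighbourhood of the equilibrium when both gains are large. -/
theorem exists_gains_errField (hN : 2 ≤ N) {f : Fin N → (Fin N → ℝ) → ℝ}
    (hf : ∀ i, ContDiff ℝ 2 (f i)) {m : ℝ} (hm : 0 < m) (hmono : StronglyMonotone f m)
    {xs : Fin N → ℝ} (hxs : ∀ i, ownPartial f i xs = 0) {a : Matrix (Fin N) (Fin N) ℝ}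
    (ha : IsUndirectedConnected a) {k₁ k₂ : Fin N → ℝ} (hk₁ : ∀ i, 0 < k₁ i)
    (hk₂ : ∀ i, 0 < k₂ i) {θbar : Fin N → Fin N → ℝ} (hθbar : ∀ i j, 0 < θbar i j)
    (t₀ B R₀ : ℝ) {ε : ℝ} (hε : 0 < ε) :
    ∃ R θs σs : ℝ, 1 ≤ θs ∧ 1 ≤ σs ∧ ∀ θ σ, θs < θ → σs < σ → ∃ T, t₀ ≤ T ∧
      ∀ (w : Fin N → ℝ → ℝ) (γ : ℝ → ErrSpace N), (∀ t, t₀ ≤ t → ∀ i, |w i t| ≤ B) →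
        ContinuousOn γ (Ici t₀) → ‖γ t₀‖ ≤ R₀ →
        (∀ t, t₀ ≤ t → ‖γ t‖ ≤ R → HasDerivWithinAt γ
          (errField (ownPartial f) a k₁ k₂ θbar θ σ (fun i => w i t) (γ t)) (Ici t₀) t) →
        (∀ t, t₀ ≤ t → ‖γ t‖ ≤ R) ∧
        ∀ t, T ≤ t → σ ^ 2 * lyapE k₁ k₂ (γ t) ≤ ε ∧ lyapQ θbar (γ t) ≤ ε ∧ lyapP xs (γ t) ≤ ε := by
  obtain ⟨α, hα, Ce, hCe, hE⟩ := exists_lyapE_deriv_le hk₁ hk₂ B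
  obtain ⟨β, hβ, Cq, hCq, hQ⟩ := exists_lyapQ_deriv_le hN ha k₁ hk₂ hθbar
  obtain ⟨M, hM, hMle⟩ := exists_lyap_le k₁ k₂ xs θbar R₀
  -- `Rq` lies above the initial bound `M` and above the equilibrium level `Cq * M / β` of `lyapQ`
  -- when `lyapE ≤ M`.
  obtain ⟨Rq, hRqM, hRq⟩ : ∃ Rq, M ≤ Rq ∧ Cq * M < β * Rq := by
    refine ⟨M + Cq * M / β, by have : 0 ≤ Cq * M / β := by positivity
                               linarith, ?_⟩
    have : β * (M + Cq * M / β) = β * M + Cq * M := by field_simp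
    rw [this]
    linarith [mul_pos hβ hM]
  -- The level `Rq + 1` covers all three bounds `M`, `Rq` and `M + 1`. The constants `Cp`, `Cd`, `K`
  -- and `CL` below may depend on this ball.
  obtain ⟨R, hR⟩ := exists_norm_le_of_lyap_le k₁ xs hk₂ hθbar (Rq + 1)
  obtain ⟨Cp, hCp, Cd, hCd, hP⟩ := exists_lyapP_deriv_le hf hm hmono hxs a k₁ k₂ hθbar R B
  obtain ⟨K, hK⟩ := exists_abs_slowField_le (contDiff_ownPartial hf) k₁ k₂ R B
  obtain ⟨CL, hCL, hQ⟩ := hQ K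
  obtain ⟨θs, σs, hθs, hσs, hcas⟩ := exists_gains_of_cascade hα hβ hm hCe hCq hCL hCp hCd hM hRq
    hM.le hε
  refine ⟨R, θs, σs, hθs, hσs, fun θ σ hθ hσ => ?_⟩
  obtain ⟨hinv, T, hT, hlim⟩ := hcas θ σ t₀ hθ hσ
  refine ⟨T, hT, fun w γ hw hcont h0 hγ => ?_⟩
  have hσ1 : 1 ≤ σ := by linarith
  have hC : IsCascade α β m Ce Cq CL Cp Cd M Rq M θ σ t₀ (fun t => lyapE k₁ k₂ (γ t))
      (fun t => lyapQ θbar (γ t)) fun t => lyapP xs (γ t) :=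
    { nonneg_e := fun t => lyapE_nonneg hk₂ _
      nonneg_q := fun t => lyapQ_nonneg hθbar _
      nonneg_p := fun t => lyapP_nonneg xs _
      cont_e := (continuous_lyapE k₁ k₂).comp_continuousOn hcont
      cont_q := (continuous_lyapQ θbar).comp_continuousOn hcont
      cont_p := (continuous_lyapP xs).comp_continuousOn hcont
      init_e := (hMle _ h0).1
      init_q := (hMle _ h0).2.1.trans hRqM
      init_p := (hMle _ h0).2.2
      deriv_le := fun t ht he hq hp => by
        have hz : ‖γ t‖ ≤ R := hR _ (by linarith) (by linarith) (by linarith)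
        have hd := hγ t ht hz
        exact ⟨_, _, _, hasDerivWithinAt_lyapE k₁ k₂ hd, hasDerivWithinAt_lyapQ θbar hd,
          hasDerivWithinAt_lyapP xs hd,
          hE _ a θbar θ σ _ _ (by linarith) (hw t ht) _ rfl,
          hQ _ θ σ _ _ (by linarith) (hK σ _ _ hσ1 (hw t ht) hz) _ rfl,
          hP θ σ _ _ (hw t ht) hz _ rfl⟩ }
  refine ⟨fun t ht => ?_, fun t ht => hlim _ _ _ hC t ht⟩
  obtain ⟨h1, h2, h3⟩ := hinv _ _ _ hC t ht
  exact hR _ (by linarith) (by linarith) (by linarith)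

end NashPI

end

theorem theorem1 (N : ℕ) (hN : 2 ≤ N)
    (f : Fin N → (Fin N → ℝ) → ℝ) (hf : ∀ i, ContDiff ℝ 2 (f i))
    (hmono : ∃ m : ℝ, 0 < m ∧ NashPI.StronglyMonotone f m)
    (a : Matrix (Fin N) (Fin N) ℝ) (ha : NashPI.IsUndirectedConnected a)
    (t₀ : ℝ) (d : Fin N → ℝ → ℝ) (hd : ∀ i, NashPI.IsAdmissibleDisturbance t₀ (d i))
    (k₁ k₂ : Fin N → ℝ) (hk₁ : ∀ i, 0 < k₁ i) (hk₂ : ∀ i, 0 < k₂ i)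
    (θbar : Fin N → Fin N → ℝ) (hθbar : ∀ i j, 0 < θbar i j) :
    (∃! xs : Fin N → ℝ, NashPI.IsNash f xs) ∧
    ∀ xs : Fin N → ℝ, NashPI.IsNash f xs →
      ∀ v₁ v₂ : ℝ, 0 < v₁ → 0 < v₂ →
        ∃ θs σs : ℝ, 0 < θs ∧ 0 < σs ∧
          ∀ θ σ : ℝ, θs < θ → σs < σ →
            (∀ s₀ : NashPI.State N, ‖NashPI.errorVec xs (fun i => d i t₀) s₀‖ ≤ v₁ →
              ∃ s : ℝ → NashPI.State N,
                NashPI.IsSolution f a t₀ d k₁ k₂ θbar θ σ s ∧ s t₀ = s₀) ∧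
            ∃ T : ℝ, t₀ ≤ T ∧
              ∀ s : ℝ → NashPI.State N, NashPI.IsSolution f a t₀ d k₁ k₂ θbar θ σ s →
                ‖NashPI.errorVec xs (fun i => d i t₀) (s t₀)‖ ≤ v₁ →
                ∀ t : ℝ, T ≤ t → ‖NashPI.errorVec xs (fun i => d i t) (s t)‖ ≤ v₂ := by
  obtain ⟨m, hm, hmono⟩ := hmono
  refine ⟨NashPI.existsUnique_isNash hf hm hmono, fun xs hxs v₁ v₂ hv₁ hv₂ => ?_⟩
  rw [NashPI.isNash_iff_ownPartial_eq_zero hf hm hmono] at hxs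
  obtain ⟨w, B, hwc, hwB, hwd⟩ := NashPI.exists_disturbance_bound hd
  obtain ⟨R₀, hR₀⟩ := NashPI.exists_norm_toErr_le k₁ k₂ xs hv₁.le
  obtain ⟨ε, hε, hεv⟩ := NashPI.exists_norm_errorVec_le k₁ xs hk₂ hθbar hv₂
  obtain ⟨R, θs, σs, hθs, hσs, hgain⟩ := NashPI.exists_gains_errField hN hf hm hmono hxs ha hk₁ hk₂
    hθbar t₀ B R₀ hε
  refine ⟨θs, σs, by linarith, by linarith, fun θ σ hθ hσ => ?_⟩
  obtain ⟨T, hT, hT'⟩ := hgain θ σ hθ hσ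
  have hσ1 : 1 ≤ σ := by linarith
  have hσ0 : 0 < σ := by linarith
  refine ⟨fun s₀ hs₀ => ?_, T, hT, fun s hs hs₀ t ht => ?_⟩
  · obtain ⟨γ, hγ0, hγc, hγ⟩ := NashPI.exists_cutoff_solution (NashPI.contDiff_ownPartial hf) a k₁ k₂
      θbar θ σ hwc hwB R (NashPI.toErr k₁ k₂ σ (fun i => d i t₀) s₀)
    -- The cut-off trajectory stays in the ball where the field is unmodified, so it solves the true
    -- error dynamics.
    have hbd := (hT' w γ hwB hγc (by rw [hγ0]; exact hR₀ σ _ s₀ hσ1 hs₀) hγ).1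
    refine ⟨_, NashPI.isSolution_ofErr hwd hk₂ hσ0 fun t ht => hγ t ht (hbd t ht), ?_⟩
    simp only [hγ0, NashPI.ofErr_toErr k₁ k₂ hσ0]
  · have hder := fun t ht => hs.hasDerivWithinAt_toErr hwd hk₂ hσ0 (t := t) ht
    obtain ⟨h1, h2, h3⟩ := (hT' w _ hwB (fun t ht => (hder t ht).continuousWithinAt)
      (hR₀ σ _ _ hσ1 hs₀) fun t ht _ => hder t ht).2 t ht
    exact hεv σ _ _ hσ1 _ rfl h1 h2 h3
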